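/- Let $F$ be an infinite field and let $Q$ be a finite quiver with vertex set $Q_0$ and arrow set $Q_1$; write $ta$ and $ha$ for the tail and head of an arrow $a$. Let $\alpha,\beta\in\mathbb{N}^{Q_0}$ be dimension vectors and let $W$ be a representation of $Q$ over $F$ of dimension vector $\beta$. For a representation $V$ of $Q$, $\operatorname{Hom}_Q(V,W)$ and $\operatorname{Ext}_Q(V,W)$ are the kernel and the cokernel of the linear map $$\bigoplus_{x\in Q_0}\operatorname{Hom}(V(x),W(x))\to\bigoplus_{a\in Q_1}\operatorname{Hom}(V(ta),W(ha)),\qquad \varphi\mapsto\big(\varphi(ha)V(a)-W(a)\varphi(ta)\big)_{a}.$$ For a dimension vector $\gamma$, a representation $V\in\operatorname{Rep}_\gamma(Q)$ is called $(\gamma,W)$-general if $\dim\operatorname{Hom}_Q(V,W)$ is minimal among all $V\in\operatorname{Rep}_\gamma(Q)$, and $\hom(\gamma,W)=\dim\operatorname{Hom}_Q(V,W)$, $\operatorname{ext}(\gamma,W)=\dim\operatorname{Ext}_Q(V,W)$ for any such $V$. Then the limits $$\operatorname{nchom}(\alpha,W)=\lim_{d\to\infty}\frac{\hom(d\alpha,W)}{d},\qquad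 \operatorname{ncext}(\alpha,W)=\lim_{d\to\infty}\frac{\operatorname{ext}(d\alpha,W)}{d}$$ exist, and for every integer $d\ge 1$ with $$d\ \ge\ \min\Big\{\sum_{x\in Q_0}\alpha(x)\beta(x)-1,\ \sum_{a\in Q_1}\alpha(ta)\beta(ha)-1\Big\}$$ (in particular for $d$ equal to this minimum, when the minimum is at least $1$) one has $$\operatorname{nchom}(\alpha,W)=\frac{\hom(d\alpha,W)}{d}\qquad\text{and}\qquad \operatorname{ncext}(\alpha,W)=\frac{\operatorname{ext}(d\alpha,W)}{d}.$$ -/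

import Mathlib

open Filter Topology

universe u v v' w w'

/-- A (finite-dimensional) representation of a quiver `Q` over a field `F`: a finite-dimensional
vector space at each vertex and a linear map for each arrow. -/
structure QuiverRep (F : Type u) [Field F] (Q : Type v) [Quiver.{v'} Q] where
  space : Q → Type w
  [addCommGroup : ∀ x, AddCommGroup (space x)]
  [module : ∀ x, Module F (space x)]
  [finiteDimensional : ∀ x, FiniteDimensional F (space x)]
  map : ∀ {x y : Q}, (x ⟶ y) → (space x →ₗ[F] space y)

namespace QuiverRep

attribute [instance] QuiverRep.addCommGroup QuiverRep.module QuiverRep.finiteDimensional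

variable {F : Type u} [Field F] {Q : Type v} [Quiver.{v'} Q]

/-- The dimension vector of a representation. -/
noncomputable def dimVector (W : QuiverRep.{u, v, v', w} F Q) : Q → ℕ :=
  fun x => Module.finrank F (W.space x)

/-- The space `Hom_Q(V, W)` of morphisms of representations: families of linear maps `φ x`
with `φ (ha) ∘ V a = W a ∘ φ (ta)` for every arrow `a`. -/
def Hom (V : QuiverRep.{u, v, v', w} F Q) (W : QuiverRep.{u, v, v', w'} F Q) :
    Submodule F (∀ x, V.space x →ₗ[F] W.space x) where
  carrier := {φ | ∀ (x y : Q) (a : x ⟶ y), φ y ∘ₗ V.map a = W.map a ∘ₗ φ x}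
  zero_mem' := by
    intro x y a
    simp
  add_mem' := by
    intro φ ψ hφ hψ x y a
    simp only [Pi.add_apply, LinearMap.add_comp, LinearMap.comp_add]
    rw [hφ x y a, hψ x y a]
  smul_mem' := by
    intro c φ hφ x y a
    simp only [Pi.smul_apply, LinearMap.smul_comp, LinearMap.comp_smul]
    rw [hφ x y a]

/-- The differential
`⨁_x Hom(V x, W x) → ⨁_a Hom(V (ta), W (ha))`, `φ ↦ (φ (ha) ∘ V a - W a ∘ φ (ta))_a`,
of the two-term complex computing `Hom_Q(V, W)` and `Ext_Q(V, W)`. -/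
def diff (V : QuiverRep.{u, v, v', w} F Q) (W : QuiverRep.{u, v, v', w'} F Q) :
    (∀ x, V.space x →ₗ[F] W.space x) →ₗ[F]
      (∀ (x y : Q), (x ⟶ y) → (V.space x →ₗ[F] W.space y)) where
  toFun φ := fun x y a => φ y ∘ₗ V.map a - W.map a ∘ₗ φ x
  map_add' φ ψ := by
    funext x y a
    simp only [Pi.add_apply, LinearMap.add_comp, LinearMap.comp_add]
    abel
  map_smul' c φ := by
    funext x y a
    simp only [Pi.smul_apply, LinearMap.smul_comp, LinearMap.comp_smul, RingHom.id_apply,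
      smul_sub]

theorem ker_diff (V : QuiverRep.{u, v, v', w} F Q) (W : QuiverRep.{u, v, v', w'} F Q) :
    LinearMap.ker (diff V W) = Hom V W := by
  ext φ
  rw [LinearMap.mem_ker]
  constructor
  · intro h x y a
    have := congrFun (congrFun (congrFun h x) y) a
    exact sub_eq_zero.mp this
  · intro h
    funext x y a
    exact sub_eq_zero.mpr (h x y a)

/-- `Ext_Q(V, W)` (that is, `Ext¹`; the path algebra is hereditary), as the cokernel of the
standard two-term complex of the quiver. The class of `(η_a)_a` corresponds to the extension of
`V` by `W` with spaces `W x × V x` and arrow maps `(w, v) ↦ (W a w + η_a v, V a v)`; two such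
extensions are equivalent exactly if the families differ by an element of the range. -/
abbrev Ext (V : QuiverRep.{u, v, v', w} F Q) (W : QuiverRep.{u, v, v', w'} F Q) :
    Type (max v v' w w') :=
  (∀ (x y : Q), (x ⟶ y) → (V.space x →ₗ[F] W.space y)) ⧸ LinearMap.range (diff V W)

/-- `dim Hom_Q(V, W)`. -/
noncomputable def homDim (V : QuiverRep.{u, v, v', w} F Q) (W : QuiverRep.{u, v, v', w'} F Q) :
    ℕ :=
  Module.finrank F (Hom V W)

/-- `dim Ext_Q(V, W)`. -/
noncomputable def extDim (V : QuiverRep.{u, v, v', w} F Q) (W : QuiverRep.{u, v, v', w'} F Q) :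
    ℕ :=
  Module.finrank F (Ext V W)

/-- The Euler form identity `dim Hom_Q(V, W) - dim Ext_Q(V, W) = ⟨dim V, dim W⟩`. -/
theorem homDim_add_eq_extDim_add [Fintype Q] [∀ x y : Q, Fintype (x ⟶ y)]
    (V : QuiverRep.{u, v, v', w} F Q) (W : QuiverRep.{u, v, v', w'} F Q) :
    homDim V W + ∑ x, ∑ y, ∑ _a : x ⟶ y, V.dimVector x * W.dimVector y
      = extDim V W + ∑ x, V.dimVector x * W.dimVector x := by
  have h1 := LinearMap.finrank_range_add_finrank_ker (diff V W)
  have h2 := Submodule.finrank_quotient_add_finrank (LinearMap.range (diff V W))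
  rw [ker_diff] at h1
  simp only [Module.finrank_pi_fintype, Module.finrank_linearMap] at h1 h2
  simp only [homDim, extDim, Ext, dimVector]
  omega

/-- `Rep_α(Q)`: the representations with space `F^{α x}` at every vertex `x`, given by
their linear maps. -/
abbrev RepSpace (F : Type u) [Field F] {Q : Type v} [Quiver.{v'} Q] (α : Q → ℕ) :
    Type (max u v v') :=
  ∀ x y : Q, (x ⟶ y) → ((Fin (α x) → F) →ₗ[F] (Fin (α y) → F))

/-- A point of `Rep_α(Q)` as a representation. -/
def ofPoint {α : Q → ℕ} (V : RepSpace F α) : QuiverRep.{u, v, v', u} F Q where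
  space x := Fin (α x) → F
  map {x y} a := V x y a

theorem dimVector_ofPoint {α : Q → ℕ} (V : RepSpace F α) : (ofPoint V).dimVector = α := by
  funext x
  exact Module.finrank_fin_fun F

/-- The locus `Z^t(α, W) = {V ∈ Rep_α(Q) | dim Hom_Q(V, W) ≥ t}`. -/
def jumpLocus (t : ℕ) (α : Q → ℕ) (W : QuiverRep.{u, v, v', w} F Q) : Set (RepSpace F α) :=
  {V | t ≤ homDim (ofPoint V) W}

/-- The minimal value of `dim Hom_Q(V, W)` for `V ∈ Rep_α(Q)`. -/
noncomputable def minHom (α : Q → ℕ) (W : QuiverRep.{u, v, v', w} F Q) : ℕ :=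
  sInf (Set.range fun V : RepSpace F α => homDim (ofPoint V) W)

/-- `V` is `(α, W)`-general if it lies in the complement of `Z^{t+1}(α, W)`, where `t` is the
minimal value of `dim Hom_Q(-, W)` on `Rep_α(Q)`. -/
def IsGeneral (α : Q → ℕ) (W : QuiverRep.{u, v, v', w} F Q) (V : RepSpace F α) : Prop :=
  V ∉ jumpLocus (minHom α W + 1) α W

theorem isGeneral_iff {α : Q → ℕ} {W : QuiverRep.{u, v, v', w} F Q} {V : RepSpace F α} :
    IsGeneral α W V ↔ homDim (ofPoint V) W = minHom α W := by
  have h : minHom α W ≤ homDim (ofPoint V) W := Nat.sInf_le ⟨V, rfl⟩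
  simp only [IsGeneral, jumpLocus, Set.mem_ofPred_eq]
  omega

theorem exists_isGeneral (α : Q → ℕ) (W : QuiverRep.{u, v, v', w} F Q) :
    ∃ V : RepSpace F α, IsGeneral α W V := by
  obtain ⟨V, hV⟩ := Nat.sInf_mem
    (Set.range_nonempty fun V : RepSpace F α => homDim (ofPoint V) W)
  exact ⟨V, isGeneral_iff.mpr hV⟩

/-- `hom(α, W) = dim Hom_Q(V, W)` for an `(α, W)`-general `V`. -/
noncomputable def genHom (α : Q → ℕ) (W : QuiverRep.{u, v, v', w} F Q) : ℕ :=
  homDim (ofPoint (exists_isGeneral α W).choose) W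

/-- `ext(α, W) = dim Ext_Q(V, W)` for an `(α, W)`-general `V`. -/
noncomputable def genExt (α : Q → ℕ) (W : QuiverRep.{u, v, v', w} F Q) : ℕ :=
  extDim (ofPoint (exists_isGeneral α W).choose) W

/-- `hom(α, W)` does not depend on the general representation chosen. -/
theorem genHom_eq {α : Q → ℕ} {W : QuiverRep.{u, v, v', w} F Q} {V : RepSpace F α}
    (hV : IsGeneral α W V) : genHom α W = homDim (ofPoint V) W :=
  (isGeneral_iff.mp (exists_isGeneral α W).choose_spec).trans (isGeneral_iff.mp hV).symm

/-- `ext(α, W)` does not depend on the general representation chosen. -/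
theorem genExt_eq [Fintype Q] [∀ x y : Q, Fintype (x ⟶ y)]
    {α : Q → ℕ} {W : QuiverRep.{u, v, v', w} F Q} {V : RepSpace F α}
    (hV : IsGeneral α W V) : genExt α W = extDim (ofPoint V) W := by
  have h := genHom_eq hV
  have h1 := homDim_add_eq_extDim_add (ofPoint V) W
  have h2 := homDim_add_eq_extDim_add (ofPoint (exists_isGeneral α W).choose) W
  rw [dimVector_ofPoint] at h1 h2
  unfold genHom at h
  unfold genExt
  omega

/-- The non-commutative hom, `nchom(α, W) = lim_{d → ∞} hom(dα, W) / d`. -/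
noncomputable def nchom (α : Q → ℕ) (W : QuiverRep.{u, v, v', w} F Q) : ℝ :=
  limUnder atTop (fun d : ℕ => (genHom (d • α) W : ℝ) / d)

/-- The non-commutative ext, `ncext(α, W) = lim_{d → ∞} ext(dα, W) / d`. -/
noncomputable def ncext (α : Q → ℕ) (W : QuiverRep.{u, v, v', w} F Q) : ℝ :=
  limUnder atTop (fun d : ℕ => (genExt (d • α) W : ℝ) / d)

end QuiverRep

/-! Cutting each `F^{dα(x)}` into `d` blocks turns the differential of `V ∈ Rep_{dα}(Q)` into a
matrix `∑ₖ Aₖ ⊗ Tₖ`. The `Aₖ` depend only on `α` and `W`; the `Tₖ` are `d × d` blocks of `V`, except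
for one coefficient, which carries `W` and has `T = 1`. That normalisation does not lower the
maximal rank (`exists_pencil_rank_le_of_eq_one`), so `hom(dα, W)` is `d ∑ α(x)β(x)` minus the
maximal rank of the pencil over `M_d(F)`. It remains to see that this rank is `r * d` with `r`
independent of `d`, once `d + 1` is at least the smaller side of the `Aₖ`
(`exists_pencil_rank_eq_mul`). The Euler form then gives `ext`.

Two facts carry this. Regularity (`exists_full_subpencil`): the maximal rank is a multiple `r * d`,
attained on an `r × r` subpencil. Over a suitable extension `L`, a division algebra `D` spans
`M_d(L)`; since `F` is infinite, generic coefficients may be taken in `D`, and the pencil becomes a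
matrix over `D`, whose rank over `L` is its rank over `D` times `d`.

Descent (`exists_pencil_det_ne_zero_of_succ`): a square pencil of size `n ≤ d + 1` that is
invertible for some `T` in `M_{d+1}(F)` is invertible for some `T` in `M_d(F)`. Otherwise, by
regularity, all ranks at level `d` are at most `(n - 1)d`. Counting left kernels in a `d × (d+1)`
blow-up then forces `n = d + 1` and every block column to have rank at most `d`, and a generic
perturbation violates this.

Finally `r` is the largest size of a square subpencil invertible at some level. Regularity makes `r
* d` an upper bound for every `d`, and descent attains it as soon as `r ≤ d + 1`; this is the source
of the `-1` in the bound. -/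

namespace Matrix

/-! ### Invertible submatrices and minors. -/

/-- Over a division ring, every matrix `X` has an invertible square submatrix through which
it factors. -/
theorem exists_isUnit_submatrix_factor {D m n : Type*} [DivisionRing D] [Fintype m]
    [DecidableEq m] [DecidableEq n] (X : Matrix m n D) :
    ∃ (r : ℕ) (f : Fin r → m) (g : Fin r → n) (B : Matrix (Fin r) (Fin r) D),
      Function.Injective f ∧ Function.Injective g ∧
      X.submatrix f g * B = 1 ∧ B * X.submatrix f g = 1 ∧
      X = X.submatrix id g * B * X.submatrix f id := by
  classical
  let P : ℕ → Prop := fun r => ∃ (f : Fin r → m) (g : Fin r → n) (B : Matrix (Fin r) (Fin r) D),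
    X.submatrix f g * B = 1 ∧ B * X.submatrix f g = 1
  have hinj : ∀ r (f : Fin r → m) (g : Fin r → n) (B : Matrix (Fin r) (Fin r) D),
      X.submatrix f g * B = 1 → Function.Injective f := by
    intro r f g B h a b hab
    have h1 := congrFun (congrFun h a) a
    have h2 := congrFun (congrFun h b) a
    rw [mul_apply] at h1 h2
    simp only [submatrix_apply, hab] at h1 h2
    rw [h2, one_apply_eq] at h1
    by_contra hne
    rw [one_apply_ne (Ne.symm hne)] at h1
    exact zero_ne_one h1
  have hinj' : ∀ r (f : Fin r → m) (g : Fin r → n) (B : Matrix (Fin r) (Fin r) D),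
      B * X.submatrix f g = 1 → Function.Injective g := by
    intro r f g B h a b hab
    have h1 := congrFun (congrFun h a) a
    have h2 := congrFun (congrFun h a) b
    rw [mul_apply] at h1 h2
    simp only [submatrix_apply, hab] at h1 h2
    rw [h2, one_apply_eq] at h1
    by_contra hne
    rw [one_apply_ne hne] at h1
    exact zero_ne_one h1
  have hbd : ∀ r, P r → r ≤ Fintype.card m := by
    rintro r ⟨f, g, B, h, -⟩
    simpa using Fintype.card_le_of_injective f (hinj r f g B h)
  have h0 : P 0 := ⟨Fin.elim0, Fin.elim0, 1, by ext i; exact i.elim0, by ext i; exact i.elim0⟩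
  let r := Nat.findGreatest P (Fintype.card m)
  obtain ⟨f, g, B, h1, h2⟩ : P r := Nat.findGreatest_spec (Nat.zero_le _) h0
  refine ⟨r, f, g, B, hinj r f g B h1, hinj' r f g B h2, h1, h2, ?_⟩
  ext i j
  by_contra hne
  set c : Matrix (Fin 1) (Fin r) D := X.submatrix (fun _ => i) g with hc
  set b : Matrix (Fin r) (Fin 1) D := X.submatrix f (fun _ => j) with hb
  -- The Schur complement of the maximal invertible block in the block bordered by row `i` and
  -- column `j`. If it is nonzero, the bordered block is invertible, against maximality.
  set s : D := X i j - (c * B * b) 0 0 with hs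
  have hs0 : s ≠ 0 := by
    intro h
    apply hne
    rw [hs, sub_eq_zero] at h
    rw [h]
    rfl
  let σ : Matrix (Fin 1) (Fin 1) D := of fun _ _ => s
  let σ' : Matrix (Fin 1) (Fin 1) D := of fun _ _ => s⁻¹
  have hσ : σ * σ' = 1 := by
    ext a a'
    fin_cases a; fin_cases a'
    simp [σ, σ', mul_apply, hs0]
  have hσ' : σ' * σ = 1 := by
    ext a a'
    fin_cases a; fin_cases a'
    simp [σ, σ', mul_apply, hs0]
  let e : Matrix (Fin 1) (Fin 1) D := X.submatrix (fun _ => i) (fun _ => j)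
  have he : e = c * B * b + σ := by
    ext a a'
    fin_cases a; fin_cases a'
    simp [e, σ, hs]
  let Y := fromBlocks (X.submatrix f g) b c e
  -- The Schur complement formula for the inverse, with factors ordered for a noncommutative `D`.
  let Z := fromBlocks (B + B * b * σ' * c * B) (-(B * b * σ')) (-(σ' * c * B)) σ'
  have hYZ : Y * Z = 1 := by
    simp only [Y, Z, fromBlocks_multiply]
    rw [← fromBlocks_one]
    congr 1
    · have : X.submatrix f g * (B + B * b * σ' * c * B)
          = X.submatrix f g * B + (X.submatrix f g * B) * b * σ' * c * B := by
        simp only [Matrix.mul_add, Matrix.mul_assoc]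
      rw [this, h1]
      simp only [Matrix.mul_neg, Matrix.one_mul, Matrix.mul_assoc]
      abel
    · have : X.submatrix f g * (-(B * b * σ')) = - ((X.submatrix f g * B) * b * σ') := by
        simp only [Matrix.mul_neg, Matrix.mul_assoc]
      rw [this, h1]
      simp
    · have : e * (-(σ' * c * B)) = - (c * B * b * σ' * c * B) - (σ * σ') * c * B := by
        rw [he]
        simp only [Matrix.mul_neg, Matrix.add_mul, Matrix.mul_assoc]
        abel
      rw [this, hσ]
      simp only [Matrix.mul_add, Matrix.one_mul, Matrix.mul_assoc]
      abel
    · rw [he, Matrix.add_mul, hσ]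
      simp only [Matrix.mul_neg, Matrix.mul_assoc]
      abel
  have hZY : Z * Y = 1 := by
    simp only [Y, Z, fromBlocks_multiply]
    rw [← fromBlocks_one]
    congr 1
    · have : (B + B * b * σ' * c * B) * X.submatrix f g
          = B * X.submatrix f g + B * b * σ' * c * (B * X.submatrix f g) := by
        simp only [Matrix.add_mul, Matrix.mul_assoc]
      rw [this, h2]
      simp only [Matrix.neg_mul, Matrix.mul_one, Matrix.mul_assoc]
      abel
    · have : -(B * b * σ') * e = - (B * b * σ' * c * B * b) - B * b * (σ' * σ) := by
        rw [he]
        simp only [Matrix.neg_mul, Matrix.mul_add, Matrix.mul_assoc]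
        abel
      rw [this, hσ']
      simp only [Matrix.add_mul, Matrix.mul_one, Matrix.mul_assoc]
      abel
    · have : -(σ' * c * B) * X.submatrix f g = - (σ' * c * (B * X.submatrix f g)) := by
        simp only [Matrix.neg_mul, Matrix.mul_assoc]
      rw [this, h2]
      simp
    · rw [he, Matrix.mul_add, hσ']
      simp only [Matrix.neg_mul, Matrix.mul_assoc]
      abel
  let ε : Fin (r + 1) ≃ Fin r ⊕ Fin 1 := finSumFinEquiv.symm
  have hY : Y = X.submatrix (Sum.elim f fun _ => i) (Sum.elim g fun _ => j) := by
    ext a a'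
    rcases a with a | a <;> rcases a' with a' | a' <;> rfl
  have hP : P (r + 1) := by
    refine ⟨(Sum.elim f fun _ => i) ∘ ε, (Sum.elim g fun _ => j) ∘ ε, Z.submatrix ε ε, ?_, ?_⟩
    · rw [← submatrix_submatrix, ← hY, submatrix_mul_equiv, hYZ, submatrix_one_equiv]
    · rw [← submatrix_submatrix, ← hY, submatrix_mul_equiv, hZY, submatrix_one_equiv]
  exact absurd (Nat.le_findGreatest (hbd _ hP) hP) (by simp [r])

/-- A matrix over a field has a nonzero minor of size its rank. -/
theorem exists_submatrix_det_ne_zero {K m n : Type*} [Field K] [Fintype m] [Fintype n]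
    [DecidableEq m] [DecidableEq n] (X : Matrix m n K) :
    ∃ (f : Fin X.rank → m) (g : Fin X.rank → n), (X.submatrix f g).det ≠ 0 := by
  obtain ⟨r, f, g, B, -, -, h1, h2, h⟩ := X.exists_isUnit_submatrix_factor
  have hdet : (X.submatrix f g).det ≠ 0 := by
    intro h0
    have := congrArg det h1
    rw [det_mul, h0, zero_mul, det_one] at this
    exact zero_ne_one this
  have hr : X.rank = r := by
    apply le_antisymm
    · rw [h]
      exact (rank_mul_le_right _ _).trans ((rank_le_card_height _).trans (by simp))
    · have := X.rank_submatrix_le f g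
      rwa [rank_of_det_ne_zero hdet, Fintype.card_fin] at this
  rw [hr]
  exact ⟨f, g, hdet⟩

theorem le_rank_of_submatrix_det_ne_zero {K m n s : Type*} [Field K] [Fintype m] [Fintype n]
    [Fintype s] [DecidableEq s] {X : Matrix m n K} {f : s → m} {g : s → n}
    (h : (X.submatrix f g).det ≠ 0) : Fintype.card s ≤ X.rank := by
  have := X.rank_submatrix_le f g
  rwa [rank_of_det_ne_zero h] at this

/-- The determinant is a polynomial in `c` with constant coefficient `det A` and coefficient `det B`
in degree equal to the matrix size, so it is nonzero in either case. The generic choices of scalars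
below rest on this. -/
theorem finite_setOf_det_add_smul_eq_zero {K s : Type*} [Field K] [Fintype s] [DecidableEq s]
    (A B : Matrix s s K) (h : A.det ≠ 0 ∨ B.det ≠ 0) : {c : K | (A + c • B).det = 0}.Finite := by
  let p : Polynomial K := det ((Polynomial.X : Polynomial K) • B.map Polynomial.C
    + A.map Polynomial.C)
  have hp : p ≠ 0 := by
    intro h0
    rcases h with h | h
    · apply h
      rw [← Polynomial.coeff_det_X_add_C_zero B A]
      exact (congrArg (fun q => Polynomial.coeff q 0) h0).trans (Polynomial.coeff_zero _)
    · apply h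
      rw [← Polynomial.coeff_det_X_add_C_card B A]
      exact (congrArg (fun q => Polynomial.coeff q _) h0).trans (Polynomial.coeff_zero _)
  have he : ∀ c, p.eval c = (A + c • B).det := by
    intro c
    have : p.eval c = (Polynomial.evalRingHom c) p := rfl
    rw [this, RingHom.map_det]
    congr 1
    ext i j
    simp [add_comm]
    exact mul_comm _ _
  refine (p.finite_setOfPred_isRoot hp).subset ?_
  intro c hc
  exact (he c).trans hc

end Matrix

namespace Matrix

/-! ### Density of `F`-subspaces in their spans over an extension. -/

section Density

variable {F L E s : Type*} [Field F] [Infinite F] [Field L] [Algebra F L] [AddCommGroup E]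
  [Module F E] [Module L E] [IsScalarTower F L E] [Fintype s] [DecidableEq s]

theorem exists_algebraMap_det_add_smul_ne_zero (A B : Matrix s s L) {c : L}
    (h : (A + c • B).det ≠ 0) : ∃ c' : F, (A + algebraMap F L c' • B).det ≠ 0 := by
  have hfin : {x : L | ((A + c • B) + x • B).det = 0}.Finite :=
    finite_setOf_det_add_smul_eq_zero _ _ (Or.inl h)
  have hinf : (Set.range fun c' : F => algebraMap F L c' - c).Infinite :=
    Set.infinite_range_of_injective fun x y hxy =>
      (algebraMap F L).injective (sub_left_injective hxy)
  obtain ⟨x, ⟨c', rfl⟩, hx⟩ := (hinf.sdiff hfin).nonempty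
  refine ⟨c', fun h0 => hx ?_⟩
  have : A + c • B + (algebraMap F L c' - c) • B = A + algebraMap F L c' • B := by
    rw [sub_smul]
    abel
  simpa [this] using h0

/-- An `F`-subspace with `F` infinite is Zariski dense in its span over an extension field. -/
theorem exists_mem_det_ne_zero_of_mem_span (S : Submodule F E) (φ : E →ₗ[L] Matrix s s L) {e : E}
    (he : e ∈ Submodule.span L (S : Set E)) (h : (φ e).det ≠ 0) :
    ∃ x ∈ S, (φ x).det ≠ 0 := by
  -- The base point `e₀` lets the generators be treated one at a time: in a sum, each summand is
  -- replaced while the rest is absorbed into `e₀`.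
  have key : ∀ (c : L) (e₀ : E), (φ (e₀ + c • e)).det ≠ 0 → ∃ x ∈ S, (φ (e₀ + x)).det ≠ 0 := by
    clear h
    induction he using Submodule.span_induction with
    | mem y hy =>
      intro c e₀ hc
      rw [map_add, map_smul] at hc
      obtain ⟨c', hc'⟩ := exists_algebraMap_det_add_smul_ne_zero (F := F) _ _ hc
      refine ⟨c' • y, S.smul_mem c' hy, ?_⟩
      rwa [map_add, ← algebraMap_smul L c' y, map_smul]
    | zero =>
      intro c e₀ hc
      exact ⟨0, S.zero_mem, by simpa using hc⟩
    | add y z _ _ hy hz =>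
      intro c e₀ hc
      rw [smul_add, ← add_assoc] at hc
      obtain ⟨z', hz', hc⟩ := hz c _ hc
      rw [add_right_comm] at hc
      obtain ⟨y', hy', hc⟩ := hy c _ hc
      exact ⟨z' + y', S.add_mem hz' hy', by rwa [← add_assoc]⟩
    | smul a y _ hy =>
      intro c e₀ hc
      rw [smul_smul] at hc
      exact hy _ _ hc
  simpa using key 1 0 (by simpa using h)

end Density

theorem span_pi_eq_top {F L E κ : Type*} [Semiring F] [Semiring L] [AddCommMonoid E]
    [Module F E] [Module L E] [Finite κ] (S : Submodule F E)
    (h : Submodule.span L (S : Set E) = ⊤) :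
    Submodule.span L
      ((Submodule.pi Set.univ fun _ : κ => S : Submodule F (κ → E)) : Set (κ → E)) = ⊤ := by
  classical
  cases nonempty_fintype κ
  rw [eq_top_iff]
  intro T _
  have hT : T = ∑ k, Pi.single k (T k) := by
    simp only [Finset.univ_sum_single]
  rw [hT]
  refine Submodule.sum_mem _ fun k _ => ?_
  have hk : T k ∈ Submodule.span L (S : Set E) := by rw [h]; trivial
  have := Submodule.mem_map_of_mem (f := LinearMap.single L (fun _ : κ => E) k) hk
  rw [Submodule.map_span] at this
  refine Submodule.span_mono ?_ this
  rintro _ ⟨y, hy, rfl⟩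
  intro j _
  by_cases hj : j = k
  · subst hj
    simpa using hy
  · simp [Pi.single_eq_of_ne hj]

/-! ### Pencils, and their ranks through a division algebra. -/

section Pencil

variable {F R L κ m n p q : Type*} [Field F] [Fintype κ]

/-- The matrix `∑ k, A k ⊗ T k`. -/
def pencil [AddCommMonoid R] [Module F R] (A : κ → Matrix m n F) (T : κ → Matrix p q R) :
    Matrix (m × p) (n × q) R :=
  of fun a b => ∑ k, A k a.1 b.1 • T k a.2 b.2

theorem pencil_apply [AddCommMonoid R] [Module F R] (A : κ → Matrix m n F)
    (T : κ → Matrix p q R) (a : m × p) (b : n × q) :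
    pencil A T a b = ∑ k, A k a.1 b.1 • T k a.2 b.2 := rfl

theorem pencil_transpose [AddCommMonoid R] [Module F R] (A : κ → Matrix m n F)
    (T : κ → Matrix p q R) :
    pencil (fun k => (A k)ᵀ) (fun k => (T k)ᵀ) = (pencil A T)ᵀ := rfl

theorem pencil_add [AddCommMonoid R] [Module F R] (A : κ → Matrix m n F)
    (T T' : κ → Matrix p q R) : pencil A (T + T') = pencil A T + pencil A T' := by
  ext a b
  simp [pencil_apply, Finset.sum_add_distrib]

variable [Field L] [Algebra F L]

theorem pencil_smul (A : κ → Matrix m n F) (c : L) (T : κ → Matrix p q L) :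
    pencil A (c • T) = c • pencil A T := by
  ext a b
  simp [pencil_apply, Finset.mul_sum]

theorem pencil_map_algebraMap (A : κ → Matrix m n F) (T : κ → Matrix p q F) :
    pencil A (fun k => (T k).map (algebraMap F L)) = (pencil A T).map (algebraMap F L) := by
  ext a b
  simp [pencil_apply, Algebra.smul_def]

variable {s : Type*} [Fintype s] [DecidableEq s] [Infinite F]

/-- Moves the coefficients into `S` while keeping one chosen minor nonzero. It serves both for the
image of a division algebra and for `M_p(F)`. -/
theorem exists_pencil_det_ne_zero_of_span_eq_top [Fintype p] [DecidableEq p]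
    (S : Submodule F (Matrix p p L)) (hS : Submodule.span L (S : Set (Matrix p p L)) = ⊤)
    (A : κ → Matrix m n F) {T : κ → Matrix p p L} {f : s → m × p} {g : s → n × p}
    (h : ((pencil A T).submatrix f g).det ≠ 0) :
    ∃ T' : κ → Matrix p p L, (∀ k, T' k ∈ S) ∧ ((pencil A T').submatrix f g).det ≠ 0 := by
  let φ : (κ → Matrix p p L) →ₗ[L] Matrix s s L :=
    { toFun := fun T => (pencil A T).submatrix f g
      map_add' := fun T T' => by rw [pencil_add]; rfl
      map_smul' := fun c T => by rw [pencil_smul]; rfl }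
  obtain ⟨T', hT', h'⟩ := exists_mem_det_ne_zero_of_mem_span
    (Submodule.pi Set.univ fun _ : κ => S) φ (e := T)
    (by rw [span_pi_eq_top S hS]; trivial) h
  exact ⟨T', fun k => hT' k trivial, h'⟩

theorem exists_pencil_det_ne_zero_of_algebra [Fintype p] [DecidableEq p]
    (A : κ → Matrix m n F) {T : κ → Matrix p p L} {f : s → m × p} {g : s → n × p}
    (h : ((pencil A T).submatrix f g).det ≠ 0) :
    ∃ T' : κ → Matrix p p F, ((pencil A T').submatrix f g).det ≠ 0 := by
  let ψ : Matrix p p F →ₗ[F] Matrix p p L := (Algebra.linearMap F L).mapMatrix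
  have hspan : Submodule.span L ((LinearMap.range ψ : Submodule F _) : Set (Matrix p p L)) = ⊤ := by
    rw [eq_top_iff]
    intro M _
    rw [matrix_eq_sum_single M]
    refine Submodule.sum_mem _ fun i _ => Submodule.sum_mem _ fun j _ => ?_
    have : single i j (M i j) = M i j • ψ (single i j 1) := by
      ext a b
      simp [ψ, single_apply, smul_apply]
    rw [this]
    exact Submodule.smul_mem _ _ (Submodule.subset_span ⟨_, rfl⟩)
  obtain ⟨T', hT', h'⟩ := exists_pencil_det_ne_zero_of_span_eq_top _ hspan A h
  choose T₀ hT₀ using hT'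
  refine ⟨T₀, fun h0 => h' ?_⟩
  have hTT : T' = fun k => (T₀ k).map (algebraMap F L) := by
    funext k
    rw [← hT₀ k]
    rfl
  rw [hTT, pencil_map_algebraMap, submatrix_map]
  have := (algebraMap F L).map_det ((pencil A T₀).submatrix f g)
  rw [h0, map_zero] at this
  exact this.symm

/-- A factorisation over `D` flattens to one over `R` with every size multiplied by `card p`; ranks
and inverses over `D` are transported this way. -/
theorem comp_map_mul {D R I J K : Type*} [Fintype J] [Fintype p] [DecidableEq p] [Semiring R]
    [Semiring D] (ι : D →+* Matrix p p R) (M : Matrix I J D) (N : Matrix J K D) :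
    comp I K p p R ((M * N).map ι) = comp I J p p R (M.map ι) * comp J K p p R (N.map ι) := by
  ext ⟨i, a⟩ ⟨k, b⟩
  simp [mul_apply, Fintype.sum_prod_type, sum_apply]

/-- If `D` is a division `F`-algebra spanning `M_p(L)` over an extension field `L`, then the maximal
rank of `∑ k, A k ⊗ T k` with `T k ∈ M_p(F)` is a multiple of `card p`, attained on a square
subpencil. -/
theorem exists_full_subpencil_of_divisionRing {D : Type*} [DivisionRing D] [Algebra F D]
    [Fintype p] [DecidableEq p] [Fintype m] [DecidableEq m] [Fintype n] [DecidableEq n]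
    (ι : D →ₐ[F] Matrix p p L)
    (hι : Submodule.span L (Set.range ι) = ⊤) (A : κ → Matrix m n F) :
    ∃ (r : ℕ) (f : Fin r → m) (g : Fin r → n) (T : κ → Matrix p p F),
      Function.Injective f ∧ Function.Injective g ∧
      (pencil (fun k => (A k).submatrix f g) T).det ≠ 0 ∧
      ∀ T' : κ → Matrix p p F, (pencil A T').rank ≤ r * Fintype.card p := by
  obtain ⟨T₀, hT₀⟩ : ∃ T₀ : κ → Matrix p p F, ∀ T' : κ → Matrix p p F,
      (pencil A T').rank ≤ (pencil A T₀).rank := by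
    have hfin : (Set.range fun T : κ → Matrix p p F => (pencil A T).rank).Finite :=
      (Set.finite_Iic (Fintype.card (n × p))).subset (by
        rintro _ ⟨T, rfl⟩
        exact rank_le_card_width _)
    obtain ⟨_, ⟨T₀, rfl⟩, h⟩ := Set.exists_max_image _ id hfin (Set.range_nonempty _)
    exact ⟨T₀, fun T' => h _ ⟨T', rfl⟩⟩
  obtain ⟨f₀, g₀, h₀⟩ := (pencil A T₀).exists_submatrix_det_ne_zero
  have h₁ : ((pencil A fun k => (T₀ k).map (algebraMap F L)).submatrix f₀ g₀).det ≠ 0 := by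
    rw [pencil_map_algebraMap, submatrix_map]
    have := (algebraMap F L).map_det ((pencil A T₀).submatrix f₀ g₀)
    intro h
    exact h₀ ((map_eq_zero (algebraMap F L)).mp (this.trans h))
  obtain ⟨T₁, hT₁, h₂⟩ := exists_pencil_det_ne_zero_of_span_eq_top
    (LinearMap.range ι.toLinearMap) (by rw [LinearMap.coe_range]; exact hι) A h₁
  choose δ hδ using hT₁
  -- With coefficients in `D`, the pencil is the flattening of a single matrix over `D`, and the
  -- size `r` of an invertible block through which it factors determines its rank over `L`.
  let X : Matrix m n D := of fun a b => ∑ k, A k a b • δ k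
  have hX : comp m n p p L (X.map ι) = pencil A T₁ := by
    ext ⟨a, i⟩ ⟨b, j⟩
    have : ∀ k, ι (δ k) = T₁ k := hδ
    simp [X, pencil_apply, sum_apply, this]
  obtain ⟨r, f, g, B, hf, hg, hB, -, hfac⟩ := X.exists_isUnit_submatrix_factor
  have hrank : (pencil A T₁).rank ≤ r * Fintype.card p := by
    rw [← hX, hfac]
    have h3 := comp_map_mul ι.toRingHom (X.submatrix id g * B) (X.submatrix f id)
    have h4 : comp m n p p L ((X.submatrix id g * B * X.submatrix f id).map ι)
      = comp m (Fin r) p p L ((X.submatrix id g * B).map ι)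
        * comp (Fin r) n p p L ((X.submatrix f id).map ι) := h3
    rw [h4]
    exact (rank_mul_le_right _ _).trans ((rank_le_card_height _).trans (by simp))
  have hdet : ((pencil A T₁).submatrix (Prod.map f id) (Prod.map g id)).det ≠ 0 := by
    have h3 := comp_map_mul ι.toRingHom (X.submatrix f g) B
    have h4 : comp (Fin r) (Fin r) p p L ((1 : Matrix (Fin r) (Fin r) D).map ι)
      = (pencil A T₁).submatrix (Prod.map f id) (Prod.map g id)
        * comp (Fin r) (Fin r) p p L (B.map ι) := by
      rw [← hB, ← hX]
      exact h3
    have h5 : (1 : Matrix (Fin r) (Fin r) D).map ι = 1 := Matrix.map_one _ (map_zero _) (map_one _)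
    rw [h5, comp_one] at h4
    intro h0
    have := congrArg det h4
    rw [det_mul, h0, zero_mul, det_one] at this
    exact one_ne_zero this
  obtain ⟨T, hT⟩ := exists_pencil_det_ne_zero_of_algebra A hdet
  refine ⟨r, f, g, T, hf, hg, hT, fun T' => (hT₀ T').trans (le_trans ?_ hrank)⟩
  simpa using le_rank_of_submatrix_det_ne_zero h₂

end Pencil

end Matrix

/-! ### A cyclic division algebra inside `M_d(L)`. -/

namespace Matrix

section TwistedCentralizer

variable {F L : Type*} [Field F] [Field L] [Algebra F L]

/-- The matrices `M` with `U * σ(M) = M * U`. -/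
def twistedCentralizer {s : Type*} [Fintype s] [DecidableEq s] (σ : L →ₐ[F] L) (U : Matrix s s L) :
    Subalgebra F (Matrix s s L) where
  carrier := {M | U * σ.mapMatrix M = M * U}
  mul_mem' {M N} hM hN := by
    change U * σ.mapMatrix (M * N) = M * N * U
    rw [map_mul, ← Matrix.mul_assoc, hM, Matrix.mul_assoc, hN, Matrix.mul_assoc]
  add_mem' {M N} hM hN := by
    change U * σ.mapMatrix (M + N) = (M + N) * U
    rw [map_add, Matrix.mul_add, hM, hN, Matrix.add_mul]
  algebraMap_mem' c := by
    change U * σ.mapMatrix (algebraMap F _ c) = algebraMap F _ c * U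
    rw [AlgHom.commutes, Algebra.commutes]

theorem mem_twistedCentralizer {s : Type*} [Fintype s] [DecidableEq s] {σ : L →ₐ[F] L}
    {U M : Matrix s s L} : M ∈ twistedCentralizer σ U ↔ U * σ.mapMatrix M = M * U := Iff.rfl

/-- Inverses stay in the algebra, so for the division property it is enough that nonzero elements
have nonzero determinant. -/
theorem mem_twistedCentralizer_of_mul_eq_one {s : Type*} [Fintype s] [DecidableEq s]
    {σ : L →ₐ[F] L} {U M N : Matrix s s L} (hM : M ∈ twistedCentralizer σ U) (h : M * N = 1) :
    N ∈ twistedCentralizer σ U := by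
  have h' : N * M = 1 := mul_eq_one_comm.mp h
  rw [mem_twistedCentralizer] at hM ⊢
  calc U * σ.mapMatrix N = N * (M * U) * σ.mapMatrix N := by
        rw [← Matrix.mul_assoc, h', Matrix.one_mul]
    _ = N * U * (σ.mapMatrix M * σ.mapMatrix N) := by
        rw [← hM]
        simp only [Matrix.mul_assoc]
    _ = N * U := by rw [← map_mul, h, map_one, Matrix.mul_one]

variable {d : ℕ} [NeZero d]

/-- The scalars of the weighted cyclic shift. -/
def wrapScalar (t : L) (i : ZMod d) : L := if i + 1 = 0 then t else 1

/-- The weighted cyclic shift, with `d`-th power `t`. -/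
def weightedShift (d : ℕ) [NeZero d] (t : L) : Matrix (ZMod d) (ZMod d) L :=
  of fun a b => if a = b + 1 then wrapScalar t b else 0

theorem apply_add_one_mul_wrapScalar {σ : L →ₐ[F] L} {t : L} {M : Matrix (ZMod d) (ZMod d) L}
    (hM : M ∈ twistedCentralizer σ (weightedShift d t)) (i j : ZMod d) :
    M (i + 1) (j + 1) * wrapScalar t j = wrapScalar t i * σ (M i j) := by
  have h := congrFun (congrFun (mem_twistedCentralizer.mp hM) (i + 1)) j
  rw [mul_apply, mul_apply, Finset.sum_eq_single i, Finset.sum_eq_single (j + 1)] at h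
  · simpa [weightedShift] using h.symm
  · intro b _ hb
    simp [weightedShift, hb]
  · simp
  · intro b _ hb
    have : i ≠ b := hb.symm
    simp [weightedShift, this]
  · simp

/-- The carry `d` at the wrap-around is what the scalar `t` of the weighted shift compensates. -/
theorem val_add_one_eq (i : ZMod d) :
    ((i + 1).val : ℤ) = i.val + 1 - if i + 1 = 0 then (d : ℤ) else 0 := by
  have hd : 0 < d := Nat.pos_of_ne_zero (NeZero.ne d)
  have h1 : (i + 1).val = (i.val + 1) % d := by
    rw [ZMod.val_add, ZMod.val_one_eq_one_mod, Nat.add_mod_mod]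
  have h2 := ZMod.val_lt i
  have h3 : i + 1 = 0 ↔ i.val + 1 = d := by
    rw [← ZMod.val_eq_zero, h1]
    constructor
    · intro h
      by_contra hne
      rw [Nat.mod_eq_of_lt (by omega)] at h
      omega
    · intro h
      rw [h, Nat.mod_self]
  split_ifs with h
  · rw [h, ZMod.val_zero]
    have := h3.mp h
    push_cast [← this]
    ring
  · rw [h1, Nat.mod_eq_of_lt]
    · simp
    · have : i.val + 1 ≠ d := fun h' => h (h3.mpr h')
      omega

open WithZero in
-- The exponent is congruent to the position modulo `d`, so nonzero entries in different positions
-- never have equal weight.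
theorem val_congr_of_pow_mul_exp_eq {x y : WithZero (Multiplicative ℤ)} (hx : x ≠ 0) {i j : ZMod d}
    (h : x ^ d * exp (i.val : ℤ) = y ^ d * exp (j.val : ℤ)) : i = j := by
  have hy : y ≠ 0 := by
    rintro rfl
    rw [zero_pow (NeZero.ne d), zero_mul] at h
    exact mul_ne_zero (pow_ne_zero _ hx) exp_ne_zero h
  have h' := congrArg log h
  rw [log_mul (pow_ne_zero _ hx) exp_ne_zero, log_mul (pow_ne_zero _ hy) exp_ne_zero, log_pow,
    log_pow, log_exp, log_exp] at h'
  have hdvd : (d : ℤ) ∣ i.val - j.val := ⟨log y - log x, by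
    rw [mul_sub]
    simp only [nsmul_eq_mul] at h'
    linarith⟩
  have h1 := ZMod.val_lt i
  have h2 := ZMod.val_lt j
  apply ZMod.val_injective d
  have := Int.eq_zero_of_abs_lt_dvd hdvd (by rw [abs_lt]; constructor <;> omega)
  omega

open WithZero in
-- Give the entry at `(i, j)` the weight `d * log v + i - j`. The shift is then homogeneous: `σ`
-- preserves `v`, and passing the corner multiplies by `t`, of weight `d`, just as the index drops
-- by `d`. Taking `d`-th powers of `v` avoids fractional values.
theorem weight_add_one {σ : L →ₐ[F] L} {t : L} (v : Valuation L (WithZero (Multiplicative ℤ)))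
    (hσ : ∀ x, v (σ x) = v x) (ht : v t = exp 1)
    {M : Matrix (ZMod d) (ZMod d) L} (hM : M ∈ twistedCentralizer σ (weightedShift d t))
    (i j : ZMod d) :
    v (M (i + 1) (j + 1)) ^ d * exp (((i + 1).val : ℤ) - (j + 1).val)
      = v (M i j) ^ d * exp ((i.val : ℤ) - j.val) := by
  have hw : ∀ i : ZMod d, v (wrapScalar t i) ^ d = exp ((i.val : ℤ) + 1 - (i + 1).val) := by
    intro i
    rw [val_add_one_eq]
    unfold wrapScalar
    split_ifs
    · rw [ht, ← WithZero.exp_nsmul]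
      congr 1
      simp
    · simp
  have h := congrArg (fun x => v x ^ d) (apply_add_one_mul_wrapScalar hM i j)
  simp only [map_mul, mul_pow, hσ, hw] at h
  have h1 : exp (((i + 1).val : ℤ) - (j + 1).val)
      = exp ((j.val : ℤ) + 1 - (j + 1).val) * exp (((i + 1).val : ℤ) - j.val - 1) := by
    rw [← exp_add]
    congr 1
    ring
  rw [h1, ← mul_assoc, h, mul_comm (exp _), mul_assoc, ← exp_add]
  congr 2
  ring

open WithZero in
theorem weight_eq {σ : L →ₐ[F] L} {t : L} (v : Valuation L (WithZero (Multiplicative ℤ)))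
    (hσ : ∀ x, v (σ x) = v x) (ht : v t = exp 1)
    {M : Matrix (ZMod d) (ZMod d) L} (hM : M ∈ twistedCentralizer σ (weightedShift d t))
    (i j : ZMod d) :
    v (M (i + j) j) ^ d * exp (((i + j).val : ℤ) - j.val) = v (M i 0) ^ d * exp (i.val : ℤ) := by
  have key : ∀ k : ℕ, v (M (i + k) k) ^ d * exp (((i + k).val : ℤ) - (k : ZMod d).val)
      = v (M i 0) ^ d * exp (i.val : ℤ) := by
    intro k
    induction k with
    | zero => simp
    | succ k ih =>
      rw [← ih]
      simpa [add_assoc] using weight_add_one v hσ ht hM (i + k) k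
  have := key j.val
  rwa [ZMod.natCast_zmod_val] at this

open WithZero in
-- Weights in column `0` of `M` and in `y` are distinct, so each has a unique heaviest entry, at
-- `i₀` and `j₀`. Weights being constant along cyclic diagonals, the term `j₀` strictly dominates in
-- row `i₀ + j₀` of `M *ᵥ y`, which therefore cannot vanish.
theorem eq_zero_of_twistedCentralizer_mulVec_eq_zero {σ : L →ₐ[F] L} {t : L}
    (v : Valuation L (WithZero (Multiplicative ℤ)))
    (hσ : ∀ x, v (σ x) = v x) (ht : v t = exp 1)
    {M : Matrix (ZMod d) (ZMod d) L} (hM : M ∈ twistedCentralizer σ (weightedShift d t))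
    (h0 : M ≠ 0) {y : ZMod d → L} (hy : M *ᵥ y = 0) : y = 0 := by
  by_contra hy0
  have hmax : ∀ z : ZMod d → L, z ≠ 0 → ∃ i₀, z i₀ ≠ 0 ∧ ∀ i, i ≠ i₀ →
      v (z i) ^ d * exp (i.val : ℤ) < v (z i₀) ^ d * exp (i₀.val : ℤ) := by
    intro z hz
    obtain ⟨k, hk⟩ := Function.ne_iff.mp hz
    obtain ⟨i₀, -, hi₀⟩ := Finset.univ.exists_max_image
      (fun i => v (z i) ^ d * exp (i.val : ℤ)) ⟨k, Finset.mem_univ k⟩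
    have hne : z i₀ ≠ 0 := by
      intro h
      have := hi₀ k (Finset.mem_univ k)
      rw [h, map_zero, zero_pow (NeZero.ne d), zero_mul, le_zero_iff] at this
      exact mul_ne_zero (pow_ne_zero _ ((v.ne_zero_iff).mpr hk)) exp_ne_zero this
    refine ⟨i₀, hne, fun i hi => lt_of_le_of_ne (hi₀ i (Finset.mem_univ i)) fun h => hi ?_⟩
    exact (val_congr_of_pow_mul_exp_eq ((v.ne_zero_iff).mpr hne) h.symm).symm
  have hcol : (fun i => M i 0) ≠ 0 := by
    intro h
    apply h0
    ext i j
    have h1 := weight_eq v hσ ht hM (i - j) j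
    have h2 : M (i - j) 0 = 0 := congrFun h (i - j)
    rw [h2, map_zero, zero_pow (NeZero.ne d), zero_mul, sub_add_cancel] at h1
    simpa [NeZero.ne d] using h1
  obtain ⟨i₀, hi₀, hi⟩ := hmax _ hcol
  obtain ⟨j₀, hj₀, hj⟩ := hmax y hy0
  have hrow : ∑ j, M (i₀ + j₀) j * y j = 0 := congrFun hy (i₀ + j₀)
  have hw : ∀ j, v (M (i₀ + j₀) j * y j) ^ d * exp ((i₀ + j₀).val : ℤ)
      = (v (M (i₀ + j₀ - j) 0) ^ d * exp ((i₀ + j₀ - j).val : ℤ))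
        * (v (y j) ^ d * exp (j.val : ℤ)) := by
    intro j
    rw [← weight_eq v hσ ht hM (i₀ + j₀ - j) j, sub_add_cancel, map_mul, mul_pow]
    have : exp ((i₀ + j₀).val : ℤ) = exp (((i₀ + j₀).val : ℤ) - j.val) * exp (j.val : ℤ) := by
      rw [← exp_add, sub_add_cancel]
    rw [this]
    exact mul_mul_mul_comm _ _ _ _
  have hpos : ∀ (a : WithZero (Multiplicative ℤ)) (k : ℤ), a ≠ 0 → 0 < a ^ d * exp k :=
    fun a k ha => zero_lt_iff.mpr (mul_ne_zero (pow_ne_zero _ ha) exp_ne_zero)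
  have hlt : ∀ j, j ≠ j₀ → v (M (i₀ + j₀) j * y j) < v (M (i₀ + j₀) j₀ * y j₀) := by
    intro j hjj
    have h1 : v (M (i₀ + j₀) j * y j) ^ d * exp ((i₀ + j₀).val : ℤ)
        < v (M (i₀ + j₀) j₀ * y j₀) ^ d * exp ((i₀ + j₀).val : ℤ) := by
      rw [hw, hw, add_sub_cancel_right]
      refine mul_lt_mul'' (hi _ ?_) (hj j hjj) zero_le zero_le
      intro h
      apply hjj
      have : i₀ + j₀ - j = i₀ + (j₀ - j) := by ring
      rw [this, add_eq_left, sub_eq_zero] at h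
      exact h.symm
    exact lt_of_pow_lt_pow_left₀ d zero_le (lt_of_mul_lt_mul_right h1 zero_le)
  have hne : v (M (i₀ + j₀) j₀ * y j₀) ≠ 0 := by
    intro h
    have := hw j₀
    rw [h, zero_pow (NeZero.ne d), zero_mul, add_sub_cancel_right] at this
    exact (mul_pos (hpos _ _ ((v.ne_zero_iff).mpr hi₀))
      (hpos _ _ ((v.ne_zero_iff).mpr hj₀))).ne this
  rw [← Finset.add_sum_erase _ _ (Finset.mem_univ j₀)] at hrow
  have h1 := v.map_sum_lt (s := Finset.univ.erase j₀) (f := fun j => M (i₀ + j₀) j * y j) hne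
    (fun j hj => hlt j (Finset.ne_of_mem_erase hj))
  rw [eq_neg_of_add_eq_zero_left hrow, Valuation.map_neg] at h1
  exact lt_irrefl _ h1

open WithZero in
theorem isUnit_or_eq_zero_of_valuation {σ : L →ₐ[F] L} {t : L}
    (v : Valuation L (WithZero (Multiplicative ℤ)))
    (hσ : ∀ x, v (σ x) = v x) (ht : v t = exp 1)
    (M : twistedCentralizer σ (weightedShift d t)) : IsUnit M ∨ M = 0 := by
  by_cases h0 : M = 0
  · exact Or.inr h0
  left
  have hdet : M.1.det ≠ 0 := by
    intro h
    obtain ⟨y, hy, hy'⟩ := exists_mulVec_eq_zero_iff.mpr h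
    exact hy (eq_zero_of_twistedCentralizer_mulVec_eq_zero v hσ ht M.2 (fun h => h0 (Subtype.ext h)) hy')
  have h1 : M.1 * M.1⁻¹ = 1 := mul_nonsing_inv _ (isUnit_iff_ne_zero.mpr hdet)
  have h2 : M.1⁻¹ * M.1 = 1 := nonsing_inv_mul _ (isUnit_iff_ne_zero.mpr hdet)
  exact ⟨⟨M, ⟨M.1⁻¹, mem_twistedCentralizer_of_mul_eq_one M.2 h1⟩, Subtype.ext h1, Subtype.ext h2⟩,
    rfl⟩

/-- The algebra contains the shift and `diagonal x`. Since the `x i` are distinct, the latter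
generates the diagonal idempotents over `L`, and the shift moves these to all matrix units. -/
theorem span_twistedCentralizer_eq_top {σ : L →ₐ[F] L} {t : L} (ht : t ≠ 0) (hσt : σ t = t)
    {x : ZMod d → L} (hx : Function.Injective x) (hσx : ∀ i, σ (x i) = x (i + 1)) :
    Submodule.span L (twistedCentralizer σ (weightedShift d t) :
      Set (Matrix (ZMod d) (ZMod d) L)) = ⊤ := by
  set D := twistedCentralizer σ (weightedShift d t)
  let 𝒜 : Subalgebra L (Matrix (ZMod d) (ZMod d) L) := Algebra.adjoin L D
  have hspan : Submodule.span L (D : Set (Matrix (ZMod d) (ZMod d) L)) = 𝒜.toSubmodule := by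
    rw [Algebra.adjoin_eq_span]
    congr 1
    exact (congrArg SetLike.coe (Submonoid.closure_eq D.toSubmonoid)).symm
  have hwrap : ∀ i : ZMod d, σ (wrapScalar t i) = wrapScalar t i := by
    intro i
    unfold wrapScalar
    split_ifs
    · exact hσt
    · exact map_one σ
  have hU : weightedShift d t ∈ 𝒜 := by
    refine Algebra.subset_adjoin (mem_twistedCentralizer.mpr ?_)
    congr 1
    ext a b
    simp only [weightedShift, AlgHom.mapMatrix_apply, map_apply, of_apply]
    split_ifs
    · exact hwrap b
    · exact map_zero σ
  have hdiag : diagonal x ∈ 𝒜 := by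
    refine Algebra.subset_adjoin (mem_twistedCentralizer.mpr ?_)
    ext a b
    rw [AlgHom.mapMatrix_apply, diagonal_map (map_zero σ), mul_diagonal, diagonal_mul]
    simp only [weightedShift, of_apply]
    split_ifs with h
    · rw [h, hσx, mul_comm]
    · simp
  have hE : ∀ j, single j j (1 : L) ∈ 𝒜 := by
    intro j
    let ℬ : Subalgebra L (ZMod d → L) := 𝒜.comap (diagonalAlgHom L)
    have hxB : x ∈ ℬ := hdiag
    -- The Lagrange interpolation polynomial at `x j`, evaluated at `x`.
    have hp : ∏ k ∈ Finset.univ.erase j, ((x j - x k)⁻¹ • (x - algebraMap L _ (x k))) ∈ ℬ :=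
      Subalgebra.prod_mem _ fun k _ => ℬ.smul_mem (ℬ.sub_mem hxB (ℬ.algebraMap_mem _)) _
    have hs : ∏ k ∈ Finset.univ.erase j, ((x j - x k)⁻¹ • (x - algebraMap L _ (x k)))
        = Pi.single j 1 := by
      funext a
      rw [Finset.prod_apply]
      by_cases ha : a = j
      · subst ha
        rw [Pi.single_eq_same]
        refine Finset.prod_eq_one fun k hk => ?_
        have : x a - x k ≠ 0 := sub_ne_zero.mpr fun h => Finset.ne_of_mem_erase hk (hx h).symm
        simp [this]
      · rw [Pi.single_eq_of_ne ha]
        exact Finset.prod_eq_zero (Finset.mem_erase.mpr ⟨ha, Finset.mem_univ a⟩) (by simp)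
    rw [hs] at hp
    have h : diagonal (Pi.single j 1) ∈ 𝒜 := hp
    rwa [diagonal_single] at h
  have hstep : ∀ j, single (j + 1) j (1 : L) ∈ 𝒜 := by
    intro j
    have hw : wrapScalar t j ≠ 0 := by
      unfold wrapScalar
      split_ifs
      · exact ht
      · exact one_ne_zero
    have : single (j + 1) j (1 : L)
        = (wrapScalar t j)⁻¹ • (weightedShift d t * single j j (1 : L)) := by
      ext a b
      rw [smul_apply, mul_apply, Finset.sum_eq_single j]
      · simp only [weightedShift, of_apply, single_apply]
        by_cases hb : j = b
        · subst hb
          by_cases ha : a = j + 1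
          · simp [ha, hw]
          · simp [ha, Ne.symm ha]
        · simp [hb]
      · intro k _ hk
        simp [hk.symm]
      · simp
    rw [this]
    exact 𝒜.smul_mem (𝒜.mul_mem hU (hE j)) _
  have hall : ∀ (k : ℕ) (j : ZMod d), single (j + k) j (1 : L) ∈ 𝒜 := by
    intro k j
    induction k with
    | zero => simpa using hE j
    | succ k ih =>
      have := 𝒜.mul_mem (hstep (j + k)) ih
      rw [single_mul_single_same, one_mul] at this
      simpa [add_assoc] using this
  rw [hspan, eq_top_iff]
  intro M _
  rw [matrix_eq_sum_single M]
  refine Submodule.sum_mem _ fun i _ => Submodule.sum_mem _ fun j _ => ?_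
  have h1 : single i j (M i j) = M i j • single i j (1 : L) := by
    rw [smul_single, smul_eq_mul, mul_one]
  have h2 := hall (i - j).val j
  rw [ZMod.natCast_zmod_val, add_sub_cancel] at h2
  rw [h1]
  exact 𝒜.smul_mem h2 _

end TwistedCentralizer

end Matrix

/-! ### The degree valuation, the division algebra over `F`, and regularity. -/

open WithZero in
/-- The total degree of multivariate polynomials over a domain, as a valuation. -/
noncomputable def MvPolynomial.totalDegreeValuation (s R : Type*) [CommRing R] [IsDomain R] :
    Valuation (MvPolynomial s R) (WithZero (Multiplicative ℤ)) := by
  classical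
  exact
  { toFun := fun p => if p = 0 then 0 else exp (p.totalDegree : ℤ)
    map_zero' := by simp
    map_one' := by simp
    map_mul' := fun p q => by
      by_cases hp : p = 0
      · simp [hp]
      by_cases hq : q = 0
      · simp [hq]
      simp [hp, hq, MvPolynomial.totalDegree_mul_of_isDomain hp hq]
    map_add_le_max' := fun p q => by
      by_cases hp : p = 0
      · simp [hp]
      by_cases hq : q = 0
      · simp [hq]
      by_cases hpq : p + q = 0
      · simp [hpq]
      simp only [hp, hq, hpq, if_false]
      have := MvPolynomial.totalDegree_add p q
      rcases le_max_iff.mp this with h | h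
      · exact le_max_of_le_left (exp_le_exp.mpr (by exact_mod_cast h))
      · exact le_max_of_le_right (exp_le_exp.mpr (by exact_mod_cast h)) }

open WithZero in
theorem MvPolynomial.totalDegreeValuation_of_ne_zero {s R : Type*} [CommRing R] [IsDomain R]
    {p : MvPolynomial s R} (hp : p ≠ 0) : totalDegreeValuation s R p = exp (p.totalDegree : ℤ) := by
  classical
  exact if_neg hp

namespace Matrix

/-- Every field `F` has an extension `L` for which some central simple division algebra of degree
`d` over an intermediate field is split by `L`: there is a division `F`-algebra inside `M_d(L)`
spanning it. -/
theorem exists_divisionRing_span_eq_top (F : Type u) [Field F] (d : ℕ) [NeZero d] :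
    ∃ (L : Type u) (_ : Field L) (_ : Algebra F L) (D : Type u) (_ : DivisionRing D)
      (_ : Algebra F D) (ι : D →ₐ[F] Matrix (ZMod d) (ZMod d) L),
      Submodule.span L (Set.range ι) = ⊤ := by
  let P := MvPolynomial (ZMod d) F
  let L := FractionRing P
  let ρ : P ≃ₐ[F] P := MvPolynomial.renameEquiv F (Equiv.addRight (1 : ZMod d))
  have hinj : Function.Injective ((IsScalarTower.toAlgHom F P L).comp ρ.toAlgHom) := by
    intro a b h
    exact ρ.injective (IsFractionRing.injective P L h)
  let σ : L →ₐ[F] L := IsFractionRing.liftAlgHom hinj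
  have hρX : ∀ i, ρ (MvPolynomial.X i) = MvPolynomial.X (i + 1) := fun i =>
    MvPolynomial.rename_X (R := F) (Equiv.addRight (1 : ZMod d)) i
  have hσP : ∀ p : P, σ (algebraMap P L p) = algebraMap P L (ρ p) := by
    intro p
    exact IsFractionRing.lift_algebraMap hinj p
  let v₀ := MvPolynomial.totalDegreeValuation (ZMod d) F
  have hv₀ : ∀ p : P, p ≠ 0 → v₀ p = WithZero.exp (p.totalDegree : ℤ) :=
    fun p hp => MvPolynomial.totalDegreeValuation_of_ne_zero hp
  have hS : nonZeroDivisors P ≤ v₀.supp.primeCompl := by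
    intro p hp
    have hp0 : p ≠ 0 := nonZeroDivisors.ne_zero hp
    intro h
    have h' : v₀ p = 0 := h
    rw [hv₀ p hp0] at h'
    exact WithZero.exp_ne_zero h'
  let v : Valuation L (WithZero (Multiplicative ℤ)) := v₀.extendToLocalization hS L
  have hvP : ∀ p : P, v (algebraMap P L p) = v₀ p :=
    fun p => Valuation.extendToLocalization_apply_map_apply _ _ _ _
  have hρ : ∀ p : P, v₀ (ρ p) = v₀ p := by
    intro p
    by_cases hp : p = 0
    · rw [hp, map_zero]
    · rw [hv₀ _ hp, hv₀ _ ((map_ne_zero_iff ρ ρ.injective).mpr hp)]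
      congr 2
      exact MvPolynomial.totalDegree_renameEquiv _ _
  have hσ : ∀ x : L, v (σ x) = v x := by
    intro x
    obtain ⟨a, b, -, rfl⟩ := IsFractionRing.div_surjective (A := P) x
    simp only [map_div₀, hσP, hvP, hρ]
  -- A nonzero element fixed by the cyclic permutation of variables and of degree one, as the
  -- twisting scalar must be.
  let t₀ : P := ∑ i : ZMod d, MvPolynomial.X i
  have ht₁ : t₀ ≠ 0 := by
    intro h
    have := congrArg (MvPolynomial.eval (Pi.single (0 : ZMod d) (1 : F))) h
    simp [t₀, Pi.single_apply] at this
  have hdeg : t₀.totalDegree = 1 := by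
    have hhom : t₀.IsHomogeneous 1 :=
      MvPolynomial.IsHomogeneous.sum _ _ _ fun i _ => MvPolynomial.isHomogeneous_X F i
    exact hhom.totalDegree ht₁
  have hρt : ρ t₀ = t₀ := by
    simp only [t₀, map_sum, hρX]
    exact Equiv.sum_comp (Equiv.addRight (1 : ZMod d)) fun i => (MvPolynomial.X i : P)
  have ht : v (algebraMap P L t₀) = WithZero.exp 1 := by
    rw [hvP, hv₀ _ ht₁, hdeg]
    rfl
  let D := twistedCentralizer σ (weightedShift d (algebraMap P L t₀))
  let _ : DivisionRing D := DivisionRing.ofIsUnitOrEqZero (isUnit_or_eq_zero_of_valuation v hσ ht)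
  refine ⟨L, inferInstance, inferInstance, D, inferInstance, inferInstance, D.val, ?_⟩
  have hrange : Set.range D.val = (D : Set (Matrix (ZMod d) (ZMod d) L)) := Subtype.range_coe
  rw [hrange]
  refine span_twistedCentralizer_eq_top (x := fun i => algebraMap P L (MvPolynomial.X i)) ?_ ?_ ?_ ?_
  · exact (map_ne_zero_iff _ (IsFractionRing.injective P L)).mpr ht₁
  · rw [hσP, hρt]
  · exact (IsFractionRing.injective P L).comp (MvPolynomial.X_injective)
  · intro i
    rw [hσP, hρX]

/-- The regularity lemma: the maximal rank of `∑ k, A k ⊗ T k` over `T k ∈ M_d(F)` is a multiple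
of `d`, attained on a square subpencil. -/
theorem exists_full_subpencil {F κ m n : Type*} [Field F] [Infinite F] [Fintype κ]
    [Fintype m] [DecidableEq m] [Fintype n] [DecidableEq n] (A : κ → Matrix m n F)
    {d : ℕ} (hd : 1 ≤ d) :
    ∃ (r : ℕ) (f : Fin r → m) (g : Fin r → n) (T : κ → Matrix (Fin d) (Fin d) F),
      Function.Injective f ∧ Function.Injective g ∧
      (pencil (fun k => (A k).submatrix f g) T).det ≠ 0 ∧
      ∀ T' : κ → Matrix (Fin d) (Fin d) F, (pencil A T').rank ≤ r * d := by
  have : NeZero d := ⟨by omega⟩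
  obtain ⟨L, _, _, D, _, _, ι, hι⟩ := exists_divisionRing_span_eq_top F d
  obtain ⟨r, f, g, T, hf, hg, hT, hr⟩ := exists_full_subpencil_of_divisionRing ι hι A
  let ε : Fin d ≃ ZMod d := Fintype.equivOfCardEq (by simp)
  refine ⟨r, f, g, fun k => (T k).submatrix ε ε, hf, hg, ?_, fun T' => ?_⟩
  · have := det_submatrix_equiv_self ((Equiv.refl (Fin r)).prodCongr ε)
      (pencil (fun k => (A k).submatrix f g) T)
    intro h
    exact hT (this.symm.trans h)
  · have h1 := hr fun k => (T' k).submatrix ε.symm ε.symm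
    have h2 := rank_submatrix (pencil A T') ((Equiv.refl m).prodCongr ε.symm)
      ((Equiv.refl n).prodCongr ε.symm)
    rw [ZMod.card] at h1
    exact h2.symm.trans_le h1

end Matrix

/-! ### Spaces of linear maps of small rank. -/

section LinearMaps

variable {F E E' : Type*} [Field F] [AddCommGroup E] [Module F E] [FiniteDimensional F E]
  [AddCommGroup E'] [Module F E']

/-- A space of linear maps of rank at most one has a common kernel or a common cokernel, when
source and target have dimension at least two. -/
theorem LinearMap.exists_two_le_finrank_range (S : Submodule F (E →ₗ[F] E'))
    (hE : 2 ≤ Module.finrank F E) (hE' : 2 ≤ Module.finrank F E')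
    (hker : ∀ x : E, (∀ B ∈ S, B x = 0) → x = 0)
    (hcoker : ∀ φ : E' →ₗ[F] F, (∀ B ∈ S, φ ∘ₗ B = 0) → φ = 0) :
    ∃ B ∈ S, 2 ≤ Module.finrank F (LinearMap.range B) := by
  by_contra! hS
  have hone : ∀ B ∈ S, ∀ x y, B x ≠ 0 → ∃ c : F, B y = c • B x := by
    intro B hB x y hx
    have h1 : Module.finrank F (LinearMap.range B) ≤ 1 := by
      have := hS B hB
      omega
    have hle : Submodule.span F {B x} ≤ LinearMap.range B := by
      rw [Submodule.span_singleton_le_iff_mem]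
      exact ⟨x, rfl⟩
    have heq := Submodule.eq_of_le_of_finrank_le hle (by rwa [finrank_span_singleton hx])
    have : B y ∈ Submodule.span F {B x} := by
      rw [heq]
      exact ⟨y, rfl⟩
    obtain ⟨c, hc⟩ := Submodule.mem_span_singleton.mp this
    exact ⟨c, hc.symm⟩
  -- As `B + C` and `C` agree at `x` and both have rank at most one, both ranges lie in the line of
  -- `C x`; hence so does that of `B`.
  have hL : ∀ B ∈ S, ∀ C ∈ S, ∀ x y, B x = 0 → C x ≠ 0 → ∃ c : F, B y = c • C x := by
    intro B hB C hC x y hBx hCx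
    have hx : (B + C) x = C x := by simp [hBx]
    obtain ⟨c, hc⟩ := hone (B + C) (S.add_mem hB hC) x y (by rwa [hx])
    obtain ⟨c', hc'⟩ := hone C hC x y hCx
    refine ⟨c - c', ?_⟩
    rw [hx, LinearMap.add_apply, hc'] at hc
    rw [sub_smul, ← hc, add_sub_cancel_right]
  obtain ⟨x₁, hx₁⟩ : ∃ x : E, x ≠ 0 := by
    have : Nontrivial E := Module.nontrivial_of_finrank_pos (R := F) (by omega)
    exact exists_ne 0
  obtain ⟨B, hB, hBx₁⟩ : ∃ B ∈ S, B x₁ ≠ 0 := by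
    by_contra! h
    exact hx₁ (hker _ h)
  obtain ⟨z, hz, hBz⟩ : ∃ z : E, z ≠ 0 ∧ B z = 0 := by
    have h1 := LinearMap.finrank_range_add_finrank_ker B
    have h2 := hS B hB
    have h3 : LinearMap.ker B ≠ ⊥ := by
      intro h
      rw [h, finrank_bot] at h1
      omega
    obtain ⟨z, hz, hz0⟩ := Submodule.exists_mem_ne_zero_of_ne_bot h3
    exact ⟨z, hz0, hz⟩
  obtain ⟨C, hC, hCz⟩ : ∃ C ∈ S, C z ≠ 0 := by
    by_contra! h
    exact hz (hker _ h)
  obtain ⟨φ, hφ, hφC⟩ : ∃ φ : E' →ₗ[F] F, φ ≠ 0 ∧ φ (C z) = 0 := by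
    have hlt : Submodule.span F {C z} < ⊤ := by
      rw [lt_top_iff_ne_top]
      intro h
      have := finrank_span_singleton (K := F) hCz
      rw [h, finrank_top] at this
      omega
    obtain ⟨φ, hφ, hφ'⟩ := Submodule.exists_le_ker_of_lt_top _ hlt
    exact ⟨φ, hφ, hφ' (Submodule.mem_span_singleton_self _)⟩
  obtain ⟨G, hG, y, hGy⟩ : ∃ G ∈ S, ∃ y, φ (G y) ≠ 0 := by
    by_contra! h
    exact hφ (hcoker φ fun G hG => LinearMap.ext (h G hG))
  by_cases hGz : G z = 0
  · obtain ⟨c, hc⟩ := hL G hG C hC z y hGz hCz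
    exact hGy (by rw [hc, map_smul, hφC, smul_zero])
  · obtain ⟨c, hc⟩ := hL B hB G hG z x₁ hBz hGz
    obtain ⟨c', hc'⟩ := hL B hB C hC z x₁ hBz hCz
    obtain ⟨c'', hc''⟩ := hone G hG z y hGz
    have h1 : φ (B x₁) = 0 := by rw [hc', map_smul, hφC, smul_zero]
    rw [hc, map_smul, smul_eq_mul, mul_eq_zero] at h1
    rcases h1 with h1 | h1
    · exact hBx₁ (by rw [hc, h1, zero_smul])
    · exact hGy (by rw [hc'', map_smul, h1, smul_zero])

/-- If `S` has no common kernel, `j` elements of `S` suffice to separate the points of a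
`j`-dimensional subspace. -/
theorem LinearMap.exists_fin_forall_apply_eq_zero (S : Submodule F (E →ₗ[F] E'))
    (hker : ∀ x : E, (∀ B ∈ S, B x = 0) → x = 0) (j : ℕ) (K : Submodule F E)
    (hK : Module.finrank F K ≤ j) :
    ∃ B : Fin j → E →ₗ[F] E', (∀ i, B i ∈ S) ∧ ∀ x ∈ K, (∀ i, B i x = 0) → x = 0 := by
  induction j generalizing K with
  | zero =>
    refine ⟨fun _ => 0, fun _ => S.zero_mem, fun x hx _ => ?_⟩
    have : K = ⊥ := Submodule.finrank_eq_zero.mp (by omega)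
    simpa [this] using hx
  | succ j ih =>
    by_cases hbot : K = ⊥
    · exact ⟨fun _ => 0, fun _ => S.zero_mem, fun x hx _ => by simpa [hbot] using hx⟩
    obtain ⟨x, hx, hx0⟩ := Submodule.exists_mem_ne_zero_of_ne_bot hbot
    obtain ⟨C, hC, hCx⟩ : ∃ C ∈ S, C x ≠ 0 := by
      by_contra! h
      exact hx0 (hker _ h)
    have hlt : K ⊓ LinearMap.ker C < K :=
      lt_of_le_of_ne inf_le_left fun h => hCx (h.ge hx).2
    have := Submodule.finrank_lt_finrank_of_lt hlt
    obtain ⟨B, hB, h⟩ := ih (K ⊓ LinearMap.ker C) (by omega)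
    refine ⟨Fin.cons C B, fun i => ?_, fun y hy hy' => ?_⟩
    · refine Fin.cases ?_ (fun i => ?_) i
      · exact hC
      · exact hB i
    · exact h y ⟨hy, hy' 0⟩ fun i => hy' i.succ

end LinearMaps

/-! ### Left kernels in a `d × (d+1)` blow-up. -/

namespace Matrix

variable {F κ m : Type*} [Field F] [Fintype κ] [Fintype m]

/-- If a `d × (d+1)` block matrix of full row rank has square block submatrices of corank at
least `d`, then it has at least `d + 1` rows per block, with equality only if each block column has
rank at most `d`. -/
theorem rank_blockColumn_le (A : κ → Matrix m m F) {d : ℕ} (hd : 1 ≤ d)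
    (hm : 1 ≤ Fintype.card m) (hmd : Fintype.card m ≤ d + 1)
    (hA : ∀ T : κ → Matrix (Fin d) (Fin d) F, (pencil A T).rank ≤ (Fintype.card m - 1) * d)
    (T : κ → Matrix (Fin d) (Fin (d + 1)) F)
    (hT : (pencil A T).rank = Fintype.card m * d) :
    Fintype.card m = d + 1 ∧
      ∀ j, ((pencil A T).submatrix id fun b : m => (b, j)).rank ≤ d := by
  set Y := pencil A T
  have hY : ∀ w, Yᵀ *ᵥ w = 0 → w = 0 := by
    intro w hw
    have h1 := LinearMap.finrank_range_add_finrank_ker Yᵀ.mulVecLin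
    have h2 : Module.finrank F (LinearMap.range Yᵀ.mulVecLin) = Fintype.card m * d := by
      rw [← hT, ← rank_transpose Y]
      rfl
    rw [h2, Module.finrank_fintype_fun_eq_card, Fintype.card_prod, Fintype.card_fin] at h1
    have h3 : LinearMap.ker Yᵀ.mulVecLin = ⊥ := Submodule.finrank_eq_zero.mp (by omega)
    have : w ∈ LinearMap.ker Yᵀ.mulVecLin := hw
    rw [h3] at this
    exact (Submodule.mem_bot F).mp this
  -- The left kernel of `Y` with block column `j` deleted. What remains is a `d × d` blow-up of
  -- corank at least `d`, so `H j` has dimension at least `d`.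
  let H : Fin (d + 1) → Submodule F (m × Fin d → F) := fun j =>
    LinearMap.ker (Y.submatrix id (Prod.map id j.succAbove))ᵀ.mulVecLin
  have hH : ∀ j w, w ∈ H j → ∀ b i, i ≠ j → (Yᵀ *ᵥ w) (b, i) = 0 := by
    intro j w hw b i hij
    obtain ⟨k, rfl⟩ := Fin.exists_succAbove_eq hij
    exact congrFun (LinearMap.mem_ker.mp hw) (b, k)
  have hdim : ∀ j, d ≤ Module.finrank F (H j) := by
    intro j
    have h1 := LinearMap.finrank_range_add_finrank_ker
      (Y.submatrix id (Prod.map id j.succAbove))ᵀ.mulVecLin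
    have h2 : Module.finrank F (LinearMap.range
        (Y.submatrix id (Prod.map id j.succAbove))ᵀ.mulVecLin) ≤ (Fintype.card m - 1) * d := by
      change (Y.submatrix id (Prod.map id j.succAbove))ᵀ.rank ≤ _
      rw [rank_transpose]
      exact hA fun k => (T k).submatrix id j.succAbove
    rw [Module.finrank_fintype_fun_eq_card, Fintype.card_prod, Fintype.card_fin] at h1
    have h3 : (Fintype.card m - 1) * d + d = Fintype.card m * d := by
      rw [← Nat.succ_mul]
      congr 1
      omega
    change d ≤ Module.finrank F (LinearMap.ker _)
    omega
  let Ψ : (∀ j, H j) →ₗ[F] (m × Fin d → F) :=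
    ∑ j, (H j).subtype ∘ₗ LinearMap.proj j
  have hΨ : ∀ w, Ψ w = ∑ j, (w j : m × Fin d → F) := by
    intro w
    simp [Ψ]
  have hblock : ∀ w j b, (Yᵀ *ᵥ Ψ w) (b, j) = (Yᵀ *ᵥ (w j : m × Fin d → F)) (b, j) := by
    intro w j b
    rw [hΨ, mulVec_sum, Finset.sum_apply, Finset.sum_eq_single j]
    · intro i _ hij
      exact hH i _ (w i).2 b j hij.symm
    · simp
  -- The `H j` are independent: block `j` of `Yᵀ *ᵥ ∑ wᵢ` sees only `w j`, and `Yᵀ` is injective.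
  have hinj : Function.Injective Ψ := by
    rw [← LinearMap.ker_eq_bot, LinearMap.ker_eq_bot']
    intro w hw
    funext j
    apply Subtype.ext
    apply hY
    funext ⟨b, i⟩
    by_cases hij : i = j
    · subst hij
      rw [← hblock, hw, mulVec_zero]
    · exact hH j _ (w j).2 b i hij
  have hsum := LinearMap.finrank_le_finrank_of_injective hinj
  rw [Module.finrank_pi_fintype, Module.finrank_fintype_fun_eq_card, Fintype.card_prod,
    Fintype.card_fin] at hsum
  have hge : (d + 1) * d ≤ ∑ j, Module.finrank F (H j) := by
    simpa using Finset.card_nsmul_le_sum Finset.univ (fun j => Module.finrank F (H j)) d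
      fun j _ => hdim j
  have hcard : Fintype.card m = d + 1 :=
    le_antisymm hmd (Nat.le_of_mul_le_mul_right (hge.trans hsum) (by omega))
  refine ⟨hcard, fun j => ?_⟩
  rw [hcard] at hsum
  have hdimj : Module.finrank F (H j) = d := by
    refine le_antisymm ?_ (hdim j)
    by_contra! hlt
    have : ∑ _i : Fin (d + 1), d < ∑ i, Module.finrank F (H i) :=
      Finset.sum_lt_sum (fun i _ => hdim i) ⟨j, Finset.mem_univ j, hlt⟩
    rw [Finset.sum_const, Finset.card_univ, Fintype.card_fin, smul_eq_mul] at this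
    omega
  -- When `card m = d + 1` the dimensions match exactly, so the `H j` fill the space. Only `H j`
  -- contributes to block `j`, which bounds its rank by `d`.
  have hsurj : Function.Surjective Ψ := by
    refine (LinearMap.injective_iff_surjective_of_finrank_eq_finrank ?_).mp hinj
    rw [Module.finrank_pi_fintype, Module.finrank_fintype_fun_eq_card, Fintype.card_prod,
      Fintype.card_fin, hcard]
    exact le_antisymm hsum hge
  set Yj := Y.submatrix id fun b : m => (b, j)
  rw [← rank_transpose, rank]
  have hle : LinearMap.range Yjᵀ.mulVecLin ≤ (H j).map Yjᵀ.mulVecLin := by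
    rintro _ ⟨w, rfl⟩
    obtain ⟨w, rfl⟩ := hsurj w
    refine ⟨w j, (w j).2, ?_⟩
    funext b
    exact (hblock w j b).symm
  calc _ ≤ Module.finrank F ((H j).map Yjᵀ.mulVecLin) := Submodule.finrank_mono hle
    _ ≤ Module.finrank F (H j) := Submodule.finrank_map_le _ _
    _ = d := hdimj

end Matrix

/-! ### Descent from level `d + 1` to level `d`, and the stable rank. -/

namespace Matrix

variable {F κ m n : Type*} [Field F] [Fintype κ] [Fintype m] [DecidableEq m]

theorem rank_submatrix_of_det_ne_zero {s : Type*} [Fintype s] [DecidableEq s] {X : Matrix m m F}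
    (hX : X.det ≠ 0) {f : s → m} (hf : Function.Injective f) :
    (X.submatrix f id).rank = Fintype.card s := by
  have h1 : X.submatrix f id = (1 : Matrix m m F).submatrix f id * X := by
    rw [← submatrix_id_id X, ← submatrix_mul _ _ _ _ _ Function.bijective_id]
    simp
  rw [h1, rank_mul_eq_left_of_det_ne_zero _ _ hX]
  apply le_antisymm (rank_le_card_height _)
  have h2 : (((1 : Matrix m m F).submatrix f id).submatrix id f).det ≠ 0 := by
    rw [submatrix_submatrix]
    simp [submatrix_one f hf]
  exact le_rank_of_submatrix_det_ne_zero h2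

/-- A common kernel vector `x` of the `A k` would give the kernel vector `x ⊗ e_{i₀}` of the pencil.
-/
theorem eq_zero_of_pencil_det_ne_zero {p : Type*} [Fintype p] [DecidableEq p] [Nonempty p]
    {A : κ → Matrix m m F} {T : κ → Matrix p p F} (hT : (pencil A T).det ≠ 0)
    {x : m → F} (hx : ∀ k, A k *ᵥ x = 0) : x = 0 := by
  obtain ⟨i₀⟩ := ‹Nonempty p›
  have h : pencil A T *ᵥ (fun b => x b.1 * Pi.single (M := fun _ => F) i₀ 1 b.2) = 0 := by
    funext ⟨a, i⟩
    simp only [mulVec, dotProduct, pencil_apply, Fintype.sum_prod_type, Pi.zero_apply, smul_eq_mul]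
    have : ∀ b, ∑ j, (∑ k, A k a b * T k i j) * (x b * Pi.single (M := fun _ => F) i₀ 1 j)
        = ∑ k, T k i i₀ * (A k a b * x b) := by
      intro b
      rw [Finset.sum_eq_single i₀]
      · rw [Pi.single_eq_same, mul_one, Finset.sum_mul]
        exact Finset.sum_congr rfl fun k _ => by ring
      · intro j _ hj
        rw [Pi.single_eq_of_ne hj]
        simp
      · simp
    simp only [this]
    rw [Finset.sum_comm]
    refine Finset.sum_eq_zero fun k _ => ?_
    rw [← Finset.mul_sum]
    have := congrFun (hx k) a
    simp only [mulVec, dotProduct, Pi.zero_apply] at this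
    rw [this, mul_zero]
  have h0 : (fun b : m × p => x b.1 * Pi.single (M := fun _ => F) i₀ 1 b.2) = 0 := by
    by_contra hne
    exact hT (exists_mulVec_eq_zero_iff.mp ⟨_, hne, h⟩)
  funext a
  simpa using congrFun h0 (a, i₀)

/-- Separating a space of dimension `d + 1` one dimension at a time would take `d + 1` maps. One is
saved by starting from a combination of rank at least two, whose kernel has dimension at most `d -
1`. -/
theorem exists_combinations_separating [Infinite F] {d : ℕ} {p : Type*} [Fintype p]
    [DecidableEq p] [Nonempty p] (hm : Fintype.card m = d + 1) (hd : 1 ≤ d)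
    {A : κ → Matrix m m F} {T : κ → Matrix p p F} (hT : (pencil A T).det ≠ 0) :
    ∃ c : Fin d → κ → F, ∀ x : m → F, (∀ i, (∑ k, c i k • A k) *ᵥ x = 0) → x = 0 := by
  let S : Submodule F ((m → F) →ₗ[F] (m → F)) := Submodule.span F (Set.range fun k => (A k).mulVecLin)
  have hker : ∀ x : m → F, (∀ B ∈ S, B x = 0) → x = 0 := fun x hx =>
    eq_zero_of_pencil_det_ne_zero hT fun k => hx _ (Submodule.subset_span ⟨k, rfl⟩)
  have hcoker : ∀ φ : (m → F) →ₗ[F] F, (∀ B ∈ S, φ ∘ₗ B = 0) → φ = 0 := by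
    intro φ hφ
    let y : m → F := fun a => φ (Pi.single a 1)
    have hφy : ∀ z, φ z = y ⬝ᵥ z := by
      intro z
      conv_lhs => rw [pi_eq_sum_univ' z]
      simp [y, dotProduct, mul_comm]
    -- Transposing the pencil reduces the absence of a common cokernel to that of a common kernel.
    have hT' : (pencil (fun k => (A k)ᵀ) fun k => (T k)ᵀ).det ≠ 0 := by
      rwa [pencil_transpose, det_transpose]
    have hy : y = 0 := by
      refine eq_zero_of_pencil_det_ne_zero hT' fun k => ?_
      funext b
      have h1 : φ (A k *ᵥ Pi.single b 1) = 0 :=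
        LinearMap.congr_fun (hφ _ (Submodule.subset_span ⟨k, rfl⟩)) (Pi.single b 1)
      rw [hφy, mulVec_single_one] at h1
      simpa [mulVec, dotProduct, mul_comm] using h1
    refine LinearMap.ext fun z => ?_
    rw [hφy, hy, zero_dotProduct, LinearMap.zero_apply]
  have hdim : Module.finrank F (m → F) = d + 1 := by
    rw [Module.finrank_fintype_fun_eq_card, hm]
  obtain ⟨B₀, hB₀, hrank⟩ := LinearMap.exists_two_le_finrank_range S (by omega) (by omega)
    hker hcoker
  have h1 := LinearMap.finrank_range_add_finrank_ker B₀
  obtain ⟨e, rfl⟩ : ∃ e, d = e + 1 := ⟨d - 1, by omega⟩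
  obtain ⟨B, hB, hBx⟩ := LinearMap.exists_fin_forall_apply_eq_zero S hker e
    (LinearMap.ker B₀) (by omega)
  have hC : ∀ i : Fin (e + 1), ∃ c : κ → F,
      ∑ k, c k • (A k).mulVecLin = (Fin.cons B₀ B : Fin (e + 1) → _) i := by
    intro i
    apply (Submodule.mem_span_range_iff_exists_fun F).mp
    refine Fin.cases hB₀ hB i
  choose c hc using hC
  refine ⟨c, fun x hx => ?_⟩
  have hx' : ∀ i, (Fin.cons B₀ B : Fin (e + 1) → ((m → F) →ₗ[F] (m → F))) i x = 0 := by
    intro i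
    rw [← hx i, ← hc i, LinearMap.sum_apply, sum_mulVec]
    simp [smul_mulVec]
  exact hBx x (hx' 0) fun i => hx' i.succ

/-- Descent: fullness of the `(d+1)`-st blow-up of a square pencil forces a rank of the `d`-th
blow-up exceeding that of any non-full regular value. -/
theorem exists_lt_pencil_rank [Infinite F] {A : κ → Matrix m m F} {d : ℕ} (hd : 1 ≤ d)
    (hm : 1 ≤ Fintype.card m) (hmd : Fintype.card m ≤ d + 1)
    {T : κ → Matrix (Fin (d + 1)) (Fin (d + 1)) F} (hT : (pencil A T).det ≠ 0) :
    ∃ T' : κ → Matrix (Fin d) (Fin d) F, (Fintype.card m - 1) * d < (pencil A T').rank := by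
  by_contra! hA
  let T₁ : κ → Matrix (Fin d) (Fin (d + 1)) F := fun k => (T k).submatrix Fin.castSucc id
  have hT₁ : (pencil A T₁).rank = Fintype.card m * d := by
    have := rank_submatrix_of_det_ne_zero hT
      (f := (Prod.map id Fin.castSucc : m × Fin d → m × Fin (d + 1)))
      (Function.injective_id.prodMap (Fin.castSucc_injective d))
    rw [Fintype.card_prod, Fintype.card_fin] at this
    exact this
  obtain ⟨hcard, -⟩ := rank_blockColumn_le A hd hm hmd hA T₁ hT₁
  obtain ⟨c, hc⟩ := exists_combinations_separating hcard hd hT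
  -- Block column `0` of `pencil A Z` stacks the `d` separating combinations, so it is injective, of
  -- rank `d + 1`. A generic `T₁ + c₀ • Z` keeps both this rank and the full row rank of `T₁`.
  let Z : κ → Matrix (Fin d) (Fin (d + 1)) F := fun k => of fun i j => if j = 0 then c i k else 0
  let col : m → m × Fin (d + 1) := fun b => (b, 0)
  have hZ : ((pencil A Z).submatrix id col).rank = Fintype.card m := by
    have h1 := LinearMap.finrank_range_add_finrank_ker ((pencil A Z).submatrix id col).mulVecLin
    have h2 : LinearMap.ker ((pencil A Z).submatrix id col).mulVecLin = ⊥ := by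
      rw [LinearMap.ker_eq_bot']
      intro x hx
      apply hc
      intro i
      funext a
      have := congrFun hx (a, i)
      simp only [mulVecLin_apply, mulVec, dotProduct, submatrix_apply, id, pencil_apply, Z, col,
        of_apply, if_true, smul_eq_mul, Pi.zero_apply] at this
      simpa [mulVec, dotProduct, sum_apply, mul_comm] using this
    rw [h2, finrank_bot, add_zero, Module.finrank_fintype_fun_eq_card] at h1
    exact h1
  obtain ⟨f₁, g₁, h₁⟩ := (pencil A T₁).exists_submatrix_det_ne_zero
  obtain ⟨f₂, g₂, h₂⟩ := ((pencil A Z).submatrix id col).exists_submatrix_det_ne_zero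
  have hfin₁ := finite_setOf_det_add_smul_eq_zero _ ((pencil A Z).submatrix f₁ g₁) (Or.inl h₁)
  have hfin₂ := finite_setOf_det_add_smul_eq_zero
    (((pencil A T₁).submatrix id col).submatrix f₂ g₂) _ (Or.inr h₂)
  obtain ⟨c₀, hc₀⟩ := (hfin₁.union hfin₂).infinite_compl.nonempty
  rw [Set.mem_compl_iff, Set.mem_union, not_or] at hc₀
  let T₂ := T₁ + c₀ • Z
  have hp : pencil A T₂ = pencil A T₁ + c₀ • pencil A Z := by
    rw [pencil_add, pencil_smul]
  have hr₁ : (pencil A T₂).rank = Fintype.card m * d := by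
    apply le_antisymm
    · exact (rank_le_card_height _).trans (by simp)
    · rw [← hT₁]
      have h : ((pencil A T₂).submatrix f₁ g₁).det ≠ 0 := by
        rw [hp]
        exact hc₀.1
      simpa using le_rank_of_submatrix_det_ne_zero h
  have hr₂ : Fintype.card m ≤ ((pencil A T₂).submatrix id col).rank := by
    conv_lhs => rw [← hZ]
    have h : (((pencil A T₂).submatrix id col).submatrix f₂ g₂).det ≠ 0 := by
      rw [hp]
      exact hc₀.2
    simpa using le_rank_of_submatrix_det_ne_zero h
  have := (rank_blockColumn_le A hd hm hmd hA T₂ hr₁).2 0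
  have := hr₂.trans this
  omega

theorem det_ne_zero_of_rank_eq_card {X : Matrix m m F} (hX : X.rank = Fintype.card m) :
    X.det ≠ 0 := by
  intro h
  obtain ⟨x, hx, hx'⟩ := exists_mulVec_eq_zero_iff.mpr h
  have h1 := LinearMap.finrank_range_add_finrank_ker X.mulVecLin
  have h2 : Module.finrank F (LinearMap.range X.mulVecLin) = Fintype.card m := hX
  rw [h2, Module.finrank_fintype_fun_eq_card] at h1
  have h3 : LinearMap.ker X.mulVecLin = ⊥ := Submodule.finrank_eq_zero.mp (by omega)
  have h4 : x ∈ LinearMap.ker X.mulVecLin := hx'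
  rw [h3] at h4
  exact hx ((Submodule.mem_bot F).mp h4)

/-- A rank above `(card m - 1) * d` lies below a maximal rank `r * d` by regularity, which forces `r
≥ card m`. -/
theorem exists_pencil_det_ne_zero_of_succ [Infinite F] {A : κ → Matrix m m F} {d : ℕ} (hd : 1 ≤ d)
    (hmd : Fintype.card m ≤ d + 1)
    (h : ∃ T : κ → Matrix (Fin (d + 1)) (Fin (d + 1)) F, (pencil A T).det ≠ 0) :
    ∃ T : κ → Matrix (Fin d) (Fin d) F, (pencil A T).det ≠ 0 := by
  obtain ⟨T, hT⟩ := h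
  rcases Nat.eq_zero_or_pos (Fintype.card m) with hm | hm
  · have : IsEmpty m := Fintype.card_eq_zero_iff.mp hm
    exact ⟨0, by rw [det_isEmpty]; exact one_ne_zero⟩
  obtain ⟨T', hT'⟩ := exists_lt_pencil_rank hd hm hmd hT
  obtain ⟨r, f, g, T₀, -, -, hT₀, hr⟩ := exists_full_subpencil A hd
  have h1 : Fintype.card m - 1 < r := Nat.lt_of_mul_lt_mul_right (hT'.trans_le (hr T'))
  have h2 : ((pencil A T₀).submatrix (Prod.map f id) (Prod.map g id)).det ≠ 0 := hT₀
  have h3 := le_rank_of_submatrix_det_ne_zero h2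
  refine ⟨T₀, det_ne_zero_of_rank_eq_card (le_antisymm (rank_le_card_height _) (le_trans ?_ h3))⟩
  rw [Fintype.card_prod, Fintype.card_prod, Fintype.card_fin, Fintype.card_fin]
  exact Nat.mul_le_mul_right d (by omega)

/-- Replacing `T` by `T ⊗ 1` raises the determinant to the power `k`. -/
theorem exists_pencil_det_ne_zero_mul {A : κ → Matrix m m F} {D : ℕ} (k : ℕ)
    (h : ∃ T : κ → Matrix (Fin D) (Fin D) F, (pencil A T).det ≠ 0) :
    ∃ T : κ → Matrix (Fin (D * k)) (Fin (D * k)) F, (pencil A T).det ≠ 0 := by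
  obtain ⟨T, hT⟩ := h
  let ε : Fin D × Fin k ≃ Fin (D * k) := finProdFinEquiv
  let T' : κ → Matrix (Fin (D * k)) (Fin (D * k)) F := fun i =>
    (kroneckerMap (· * ·) (T i) (1 : Matrix (Fin k) (Fin k) F)).submatrix ε.symm ε.symm
  refine ⟨T', ?_⟩
  let e : (m × Fin D) × Fin k ≃ m × Fin (D * k) :=
    (Equiv.prodAssoc m (Fin D) (Fin k)).trans ((Equiv.refl m).prodCongr ε)
  have h1 : (pencil A T').submatrix e e
      = kroneckerMap (· * ·) (pencil A T) (1 : Matrix (Fin k) (Fin k) F) := by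
    ext ⟨⟨a, i⟩, j⟩ ⟨⟨b, i'⟩, j'⟩
    simp [e, T', pencil_apply, kroneckerMap_apply, Finset.sum_mul, mul_assoc]
  rw [← det_submatrix_equiv_self e, h1]
  have h2 := det_kronecker (pencil A T) (1 : Matrix (Fin k) (Fin k) F)
  rw [det_one, one_pow, mul_one] at h2
  exact h2.trans_ne (pow_ne_zero _ hT)

/-- The maximal rank of `∑ k, A k ⊗ T k` over `T k ∈ M_d(F)` is `d` times a constant as soon as
`d + 1` is at least the size of the matrices `A k`. -/
theorem exists_pencil_rank_eq_mul [Infinite F] [Fintype n] [DecidableEq n]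
    (A : κ → Matrix m n F) :
    ∃ r : ℕ, ∀ d : ℕ, 1 ≤ d → min (Fintype.card m) (Fintype.card n) ≤ d + 1 →
      (∀ T : κ → Matrix (Fin d) (Fin d) F, (pencil A T).rank ≤ r * d) ∧
      ∃ T : κ → Matrix (Fin d) (Fin d) F, (pencil A T).rank = r * d := by
  classical
  -- The level `D` is left free, so the largest such `r` does not depend on `d`.
  let P : ℕ → Prop := fun r => ∃ (f : Fin r → m) (g : Fin r → n),
    Function.Injective f ∧ Function.Injective g ∧ ∃ D : ℕ, 1 ≤ D ∧
      ∃ T : κ → Matrix (Fin D) (Fin D) F, (pencil (fun k => (A k).submatrix f g) T).det ≠ 0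
  have hbd : ∀ r, P r → r ≤ Fintype.card m := by
    rintro r ⟨f, -, hf, -⟩
    simpa using Fintype.card_le_of_injective f hf
  have hreg : ∀ d, 1 ≤ d → ∃ r, P r ∧
      ∀ T : κ → Matrix (Fin d) (Fin d) F, (pencil A T).rank ≤ r * d := by
    intro d hd
    obtain ⟨r, f, g, T, hf, hg, hT, hr⟩ := exists_full_subpencil A hd
    exact ⟨r, ⟨f, g, hf, hg, d, hd, T, hT⟩, hr⟩
  obtain ⟨r₁, hr₁, -⟩ := hreg 1 le_rfl
  let r := Nat.findGreatest P (Fintype.card m)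
  obtain ⟨f, g, hf, hg, D, hD, hT⟩ : P r := Nat.findGreatest_spec (hbd _ hr₁) hr₁
  refine ⟨r, fun d hd hmin => ?_⟩
  have hle : ∀ T : κ → Matrix (Fin d) (Fin d) F, (pencil A T).rank ≤ r * d := by
    obtain ⟨r', hr', h⟩ := hreg d hd
    exact fun T => (h T).trans (Nat.mul_le_mul_right d (Nat.le_findGreatest (hbd _ hr') hr'))
  have hrd : Fintype.card (Fin r) ≤ d + 1 := by
    refine le_trans (le_min ?_ ?_) hmin
    · exact Fintype.card_le_of_injective f hf
    · exact Fintype.card_le_of_injective g hg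
  have hdesc : ∀ j, (∃ T : κ → Matrix (Fin (d + j)) (Fin (d + j)) F,
      (pencil (fun k => (A k).submatrix f g) T).det ≠ 0) →
      ∃ T : κ → Matrix (Fin d) (Fin d) F, (pencil (fun k => (A k).submatrix f g) T).det ≠ 0 := by
    intro j
    induction j with
    | zero => exact id
    | succ j ih =>
      exact fun h => ih (exists_pencil_det_ne_zero_of_succ (by omega) (by omega) h)
  -- `D` may be smaller than `d`; the multiple `D * d` is at least `d`, so descent can start there.
  have hfull := exists_pencil_det_ne_zero_mul d hT
  have hDd : D * d = d + (D * d - d) := by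
    have : 1 * d ≤ D * d := Nat.mul_le_mul_right d hD
    omega
  rw [hDd] at hfull
  obtain ⟨T, hT⟩ := hdesc _ hfull
  have h1 : ((pencil A T).submatrix (Prod.map f id) (Prod.map g id)).det ≠ 0 := hT
  have h2 := le_rank_of_submatrix_det_ne_zero h1
  rw [Fintype.card_prod, Fintype.card_fin, Fintype.card_fin] at h2
  exact ⟨hle, T, le_antisymm (hle T) h2⟩

/-- One of the coefficients of a pencil of maximal rank may be taken to be the identity. -/
theorem exists_pencil_rank_le_of_eq_one [Infinite F] [DecidableEq κ] [Fintype n] [DecidableEq n]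
    {p : Type*} [Fintype p] [DecidableEq p] (A : κ → Matrix m n F) (T : κ → Matrix p p F)
    (k₀ : κ) : ∃ T' : κ → Matrix p p F, T' k₀ = 1 ∧ (pencil A T).rank ≤ (pencil A T').rank := by
  obtain ⟨f, g, h⟩ := (pencil A T).exists_submatrix_det_ne_zero
  let Z : κ → Matrix p p F := Pi.single k₀ 1
  have hfin₁ := finite_setOf_det_add_smul_eq_zero _ ((pencil A Z).submatrix f g) (Or.inl h)
  have hfin₂ := finite_setOf_det_add_smul_eq_zero (T k₀) 1
    (Or.inr (by rw [det_one]; exact one_ne_zero))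
  obtain ⟨c, hc⟩ := (hfin₁.union hfin₂).infinite_compl.nonempty
  rw [Set.mem_compl_iff, Set.mem_union, not_or] at hc
  set N := T k₀ + c • (1 : Matrix p p F) with hN
  have hNdet : N.det ≠ 0 := hc.2
  have hNu : N⁻¹ * N = 1 := nonsing_inv_mul _ (isUnit_iff_ne_zero.mpr hNdet)
  let T₁ := T + c • Z
  have hT₁ : T₁ k₀ = N := by simp [T₁, Z, hN]
  -- Left multiplication of all coefficients by `N⁻¹` only removes the factor `1 ⊗ N` from the
  -- pencil.
  refine ⟨fun k => N⁻¹ * T₁ k, (congrArg (N⁻¹ * ·) hT₁).trans hNu, ?_⟩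
  have h1 : (pencil A T).rank ≤ (pencil A T₁).rank := by
    have h' : ((pencil A T₁).submatrix f g).det ≠ 0 := by
      rw [pencil_add, pencil_smul]
      exact hc.1
    simpa using le_rank_of_submatrix_det_ne_zero h'
  refine h1.trans ?_
  have h2 : pencil A T₁
      = kroneckerMap (· * ·) (1 : Matrix m m F) N * pencil A (fun k => N⁻¹ * T₁ k) := by
    have hk : ∀ k, T₁ k = N * (N⁻¹ * T₁ k) := by
      intro k
      rw [← Matrix.mul_assoc, mul_eq_one_comm.mp hNu, Matrix.one_mul]
    ext ⟨a, i⟩ ⟨b, j⟩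
    rw [mul_apply, Fintype.sum_prod_type, Finset.sum_eq_single a]
    · simp only [kroneckerMap_apply, one_apply_eq, one_mul, pencil_apply, smul_eq_mul,
        Finset.mul_sum]
      rw [Finset.sum_comm]
      refine Finset.sum_congr rfl fun k _ => ?_
      conv_lhs => rw [hk k, mul_apply, Finset.mul_sum]
      exact Finset.sum_congr rfl fun l _ => by ring
    · intro a' _ ha
      simp [one_apply_ne ha.symm]
    · simp
  rw [h2]
  exact rank_mul_le_right _ _

end Matrix

namespace Matrix

theorem pencil_mulVec {F κ m n p q : Type*} [Field F] [Fintype κ] [Fintype n] [Fintype q]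
    (A : κ → Matrix m n F) (T : κ → Matrix p q F) (ψ : n × q → F) (r : m) (k : p) :
    (pencil A T *ᵥ ψ) (r, k) = ∑ i, ∑ l, T i k l * (A i *ᵥ fun c => ψ (c, l)) r := by
  simp only [mulVec, dotProduct, pencil_apply, Fintype.sum_prod_type, smul_eq_mul, Finset.sum_mul,
    Finset.mul_sum]
  have h : ∀ c, ∑ l, ∑ i, A i r c * T i k l * ψ (c, l) = ∑ i, ∑ l, A i r c * T i k l * ψ (c, l) :=
    fun c => Finset.sum_comm
  simp only [h]
  rw [Finset.sum_comm]
  refine Finset.sum_congr rfl fun i _ => ?_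
  rw [Finset.sum_comm]
  exact Finset.sum_congr rfl fun l _ => Finset.sum_congr rfl fun c _ => by ring

end Matrix

/-! ### The differential of a representation of dimension `dα` as a pencil. -/

namespace QuiverRep

open Matrix

variable {F : Type u} [Field F] {Q : Type v} [Quiver.{v'} Q]

/-- The arrows of a quiver, with their tail and head. -/
abbrev Arrow (Q : Type v) [Quiver.{v'} Q] : Type (max v v') := Σ x y : Q, (x ⟶ y)

/-- A basis of the space of a representation at a vertex. -/
noncomputable def vertexBasis (W : QuiverRep.{u, v, v', w} F Q) (x : Q) :
    Module.Basis (Fin (W.dimVector x)) F (W.space x) :=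
  Module.finBasis F (W.space x)

/-- Indices of the matrix coordinates on `⨁ₓ Hom(F^{α x}, W x)`. -/
abbrev ColIndex (α : Q → ℕ) (W : QuiverRep.{u, v, v', w} F Q) : Type v :=
  Σ x : Q, Fin (α x) × Fin (W.dimVector x)

/-- Indices of the matrix coordinates on `⨁ₐ Hom(F^{α (ta)}, W (ha))`. -/
abbrev RowIndex (α : Q → ℕ) (W : QuiverRep.{u, v, v', w} F Q) : Type (max v v') :=
  Σ a : Arrow Q, Fin (α a.1) × Fin (W.dimVector a.2.1)

/-- Indices of the matrix coordinates on `Rep_α(Q)`, and one more. -/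
abbrev CoeffIndex (Q : Type v) [Quiver.{v'} Q] (α : Q → ℕ) : Type (max v v') :=
  Option (Σ a : Arrow Q, Fin (α a.2.1) × Fin (α a.1))

open Classical in
/-- The coefficients of the differential `diff (ofPoint V) W` as an affine function of `V`. -/
noncomputable def diffCoeff (α : Q → ℕ) (W : QuiverRep.{u, v, v', w} F Q) :
    CoeffIndex Q α → Matrix (RowIndex α W) (ColIndex α W) F
  | none => of fun r c => -∑ b, if c = ⟨r.1.1, (r.2.1, b)⟩ then
      (W.vertexBasis r.1.2.1).repr (W.map r.1.2.2 (W.vertexBasis r.1.1 b)) r.2.2 else 0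
  | some k => of fun r c => ∑ b, if r = ⟨k.1, (k.2.2, b)⟩ then
      (if c = ⟨k.1.2.1, (k.2.1, b)⟩ then 1 else 0) else 0

theorem diffCoeff_none_mulVec [Fintype Q] {α : Q → ℕ} {W : QuiverRep.{u, v, v', w} F Q}
    (ψ : ColIndex α W → F) (a : Arrow Q) (j : Fin (α a.1)) (b' : Fin (W.dimVector a.2.1)) :
    (diffCoeff α W none *ᵥ ψ) ⟨a, (j, b')⟩ = -∑ b, ψ ⟨a.1, (j, b)⟩ *
      (W.vertexBasis a.2.1).repr (W.map a.2.2 (W.vertexBasis a.1 b)) b' := by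
  classical
  simp only [mulVec, dotProduct, diffCoeff, of_apply, neg_mul, Finset.sum_neg_distrib,
    Finset.sum_mul, ite_mul, zero_mul]
  rw [Finset.sum_comm]
  simp [mul_comm]

theorem diffCoeff_some_mulVec [Fintype Q] {α : Q → ℕ} {W : QuiverRep.{u, v, v', w} F Q}
    (ψ : ColIndex α W → F) (k : Σ a : Arrow Q, Fin (α a.2.1) × Fin (α a.1)) (r : RowIndex α W)
    [∀ b, Decidable (r = ⟨k.1, (k.2.2, b)⟩)] :
    (diffCoeff α W (some k) *ᵥ ψ) r = ∑ b, if r = ⟨k.1, (k.2.2, b)⟩ then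
      ψ ⟨k.1.2.1, (k.2.1, b)⟩ else 0 := by
  classical
  simp only [mulVec, dotProduct, diffCoeff, of_apply, Finset.sum_mul, ite_mul, zero_mul, one_mul]
  rw [Finset.sum_comm]
  refine Finset.sum_congr rfl fun b _ => ?_
  by_cases h : r = ⟨k.1, (k.2.2, b)⟩
  · simp [h]
  · simp [h]

/-- The splitting of the coordinates of `F^{d α x}` into `d` blocks. -/
def blockEquiv (d : ℕ) (α : Q → ℕ) (x : Q) : Fin (α x) × Fin d ≃ Fin ((d • α) x) :=
  finProdFinEquiv.trans (finCongr (by simp [mul_comm]))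

variable {d : ℕ} {α : Q → ℕ}

/-- The blocks of the matrices of `V ∈ Rep_{dα}(Q)`, transposed. -/
noncomputable def blockMatrices (V : RepSpace F (d • α)) :
    CoeffIndex Q α → Matrix (Fin d) (Fin d) F
  | none => 1
  | some k => of fun l l' =>
      V k.1.1 k.1.2.1 k.1.2.2 (Pi.single (blockEquiv d α k.1.1 (k.2.2, l)) 1)
        (blockEquiv d α k.1.2.1 (k.2.1, l'))

theorem exists_blockMatrices_eq {T : CoeffIndex Q α → Matrix (Fin d) (Fin d) F}
    (hT : T none = 1) : ∃ V : RepSpace F (d • α), blockMatrices V = T := by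
  classical
  refine ⟨fun x y a => Matrix.toLin' (of fun s t =>
    T (some ⟨⟨x, y, a⟩, (((blockEquiv d α y).symm s).1, ((blockEquiv d α x).symm t).1)⟩)
      ((blockEquiv d α x).symm t).2 ((blockEquiv d α y).symm s).2), ?_⟩
  funext k
  rcases k with _ | ⟨⟨x, y, a⟩, i, j⟩
  · exact hT.symm
  · ext l l'
    simp [blockMatrices]

variable (d α) in
/-- Matrix coordinates on `⨁ₓ Hom(F^{d α x}, W x)`. -/
noncomputable def colCoord (W : QuiverRep.{u, v, v', w} F Q) :
    (∀ x, (Fin ((d • α) x) → F) →ₗ[F] W.space x) →ₗ[F] (ColIndex α W × Fin d → F) where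
  toFun φ := fun c => (W.vertexBasis c.1.1).repr
    (φ c.1.1 (Pi.single (blockEquiv d α c.1.1 (c.1.2.1, c.2)) 1)) c.1.2.2
  map_add' φ ψ := by funext c; simp
  map_smul' t φ := by funext c; simp

variable (d α) in
/-- Matrix coordinates on `⨁ₐ Hom(F^{d α (ta)}, W (ha))`. -/
noncomputable def rowCoord (W : QuiverRep.{u, v, v', w} F Q) :
    (∀ x y : Q, (x ⟶ y) → ((Fin ((d • α) x) → F) →ₗ[F] W.space y)) →ₗ[F]
      (RowIndex α W × Fin d → F) where
  toFun η := fun r => (W.vertexBasis r.1.1.2.1).repr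
    (η r.1.1.1 r.1.1.2.1 r.1.1.2.2 (Pi.single (blockEquiv d α r.1.1.1 (r.1.2.1, r.2)) 1)) r.1.2.2
  map_add' φ ψ := by funext c; simp
  map_smul' t φ := by funext c; simp

theorem rowCoord_injective (W : QuiverRep.{u, v, v', w} F Q) :
    Function.Injective (rowCoord d α W) := by
  classical
  intro η η' h
  funext x y a
  refine (Pi.basisFun F _).ext fun s => ?_
  refine (W.vertexBasis y).repr.injective (Finsupp.ext fun b => ?_)
  have := congrFun h (⟨⟨x, y, a⟩, ((blockEquiv d α x).symm s).1, b⟩, ((blockEquiv d α x).symm s).2)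
  simpa [rowCoord] using this

theorem colCoord_surjective (W : QuiverRep.{u, v, v', w} F Q) :
    Function.Surjective (colCoord d α W) := by
  classical
  intro ψ
  refine ⟨fun x => (Pi.basisFun F _).constr F fun s => ∑ b,
    ψ (⟨x, ((blockEquiv d α x).symm s).1, b⟩, ((blockEquiv d α x).symm s).2) •
      W.vertexBasis x b, ?_⟩
  funext ⟨⟨x, i, b⟩, l⟩
  have h : (Pi.single (blockEquiv d α x (i, l)) 1 : Fin ((d • α) x) → F)
      = Pi.basisFun F _ (blockEquiv d α x (i, l)) := by simp
  simp only [colCoord, LinearMap.coe_mk, AddHom.coe_mk]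
  rw [h, Module.Basis.constr_basis]
  simp [Finsupp.single_apply]

/-- The differential of a point of `Rep_{α}(Q)`, on explicit spaces. -/
noncomputable def pointDiff {α : Q → ℕ} (V : RepSpace F α) (W : QuiverRep.{u, v, v', w} F Q) :
    (∀ x, (Fin (α x) → F) →ₗ[F] W.space x) →ₗ[F]
      (∀ x y : Q, (x ⟶ y) → ((Fin (α x) → F) →ₗ[F] W.space y)) :=
  diff (ofPoint V) W

theorem pointDiff_apply {α : Q → ℕ} (V : RepSpace F α) (W : QuiverRep.{u, v, v', w} F Q)
    (φ : ∀ x, (Fin (α x) → F) →ₗ[F] W.space x) (x y : Q) (a : x ⟶ y) :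
    pointDiff V W φ x y a = φ y ∘ₗ V x y a - W.map a ∘ₗ φ x := rfl

/-- The coefficient `none`, with block matrix `1`, yields the term with `W`, and the others yield
the composites with `V`. The blocks of `V` are transposed because `V` acts on `φ` by precomposition.
-/
theorem rowCoord_pointDiff [Fintype Q] [∀ x y : Q, Fintype (x ⟶ y)] (V : RepSpace F (d • α))
    (W : QuiverRep.{u, v, v', w} F Q)
    (φ : ∀ x, (Fin ((d • α) x) → F) →ₗ[F] W.space x) :
    rowCoord d α W (pointDiff V W φ)
      = pencil (diffCoeff α W) (blockMatrices V) *ᵥ colCoord d α W φ := by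
  classical
  funext ⟨⟨⟨x, y, a⟩, j, b'⟩, k⟩
  rw [pencil_mulVec, Fintype.sum_option]
  have hnone : ∑ l, blockMatrices V none k l *
      (diffCoeff α W none *ᵥ fun c => colCoord d α W φ (c, l)) ⟨⟨x, y, a⟩, (j, b')⟩
      = -(W.vertexBasis y).repr (W.map a (φ x (Pi.single (blockEquiv d α x (j, k)) 1))) b' := by
    rw [Finset.sum_eq_single k]
    · rw [diffCoeff_none_mulVec]
      simp only [blockMatrices, one_apply_eq, one_mul]
      congr 1
      conv_rhs => rw [← (W.vertexBasis x).sum_repr (φ x (Pi.single (blockEquiv d α x (j, k)) 1))]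
      simp only [map_sum, map_smul, Finsupp.coe_finsetSum, Finset.sum_apply, Finsupp.smul_apply]
      rfl
    · intro l _ hl
      simp [blockMatrices, one_apply_ne hl.symm]
    · simp
  have hsome : ∑ κ : (Σ a : Arrow Q, Fin (α a.2.1) × Fin (α a.1)), ∑ l,
      blockMatrices V (some κ) k l *
      (diffCoeff α W (some κ) *ᵥ fun c => colCoord d α W φ (c, l)) ⟨⟨x, y, a⟩, (j, b')⟩
      = (W.vertexBasis y).repr (φ y (V x y a (Pi.single (blockEquiv d α x (j, k)) 1))) b' := by
    simp only [diffCoeff_some_mulVec]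
    rw [Fintype.sum_sigma, Finset.sum_eq_single ⟨x, y, a⟩]
    · have h1 : V x y a (Pi.single (blockEquiv d α x (j, k)) 1)
          = ∑ il : Fin (α y) × Fin d, V x y a (Pi.single (blockEquiv d α x (j, k)) 1)
            (blockEquiv d α y il) • (Pi.single (blockEquiv d α y il) 1 : Fin ((d • α) y) → F) := by
        rw [(blockEquiv d α y).sum_comp fun s => V x y a (Pi.single (blockEquiv d α x (j, k)) 1) s •
          (Pi.single s 1 : Fin ((d • α) y) → F)]
        exact pi_eq_sum_univ' _
      conv_rhs => rw [h1]
      simp only [map_sum, map_smul, Finsupp.coe_finsetSum, Finset.sum_apply, Finsupp.smul_apply,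
        Fintype.sum_prod_type]
      refine Finset.sum_congr rfl fun i _ => ?_
      rw [Finset.sum_eq_single j]
      · refine Finset.sum_congr rfl fun l _ => ?_
        simp [blockMatrices, colCoord]
      · intro j' _ hj'
        simp [hj'.symm]
      · simp
    · intro a' _ ha'
      refine Finset.sum_eq_zero fun ij _ => Finset.sum_eq_zero fun l _ => ?_
      rw [Finset.sum_eq_zero, mul_zero]
      intro b _
      rw [if_neg]
      intro h
      exact ha' (congrArg Sigma.fst h).symm
    · simp
  rw [hnone, hsome]
  rw [neg_add_eq_sub]
  simp only [rowCoord, LinearMap.coe_mk, AddHom.coe_mk, pointDiff_apply, LinearMap.sub_apply,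
    LinearMap.comp_apply, map_sub, Finsupp.sub_apply]

theorem finrank_range_diff [Fintype Q] [∀ x y : Q, Fintype (x ⟶ y)] (V : RepSpace F (d • α))
    (W : QuiverRep.{u, v, v', w} F Q) :
    Module.finrank F (LinearMap.range (diff (ofPoint V) W))
      = (pencil (diffCoeff α W) (blockMatrices V)).rank := by
  have h : rowCoord d α W ∘ₗ pointDiff V W
      = (pencil (diffCoeff α W) (blockMatrices V)).mulVecLin ∘ₗ colCoord d α W :=
    LinearMap.ext fun φ => rowCoord_pointDiff V W φ
  change Module.finrank F (LinearMap.range (pointDiff V W)) = _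
  rw [Matrix.rank, ← LinearMap.range_comp_of_range_eq_top _
    (LinearMap.range_eq_top.mpr (colCoord_surjective (d := d) (α := α) W)), ← h,
    LinearMap.range_comp]
  exact (LinearEquiv.finrank_eq (Submodule.equivMapOfInjective _ (rowCoord_injective W) _))

end QuiverRep

/-! ### General hom and ext from the maximal rank. -/

namespace QuiverRep

open Matrix

variable {F : Type u} [Field F] {Q : Type v} [Quiver.{v'} Q] [Fintype Q] {α : Q → ℕ}

theorem homDim_add_finrank_range (V : RepSpace F α) (W : QuiverRep.{u, v, v', w} F Q) :
    homDim (ofPoint V) W + Module.finrank F (LinearMap.range (diff (ofPoint V) W))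
      = ∑ x, α x * W.dimVector x := by
  have h := LinearMap.finrank_range_add_finrank_ker (diff (ofPoint V) W)
  rw [ker_diff] at h
  simp only [Module.finrank_pi_fintype, Module.finrank_linearMap] at h
  have h' : ∀ x, Module.finrank F ((ofPoint V).space x) = α x := congrFun (dimVector_ofPoint V)
  simp only [h'] at h
  rw [homDim, add_comm]
  exact h

theorem genHom_add_of_forall_finrank_range_le (W : QuiverRep.{u, v, v', w} F Q) {r : ℕ}
    (hle : ∀ V : RepSpace F α, Module.finrank F (LinearMap.range (diff (ofPoint V) W)) ≤ r)
    (hex : ∃ V : RepSpace F α, r ≤ Module.finrank F (LinearMap.range (diff (ofPoint V) W))) :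
    genHom α W + r = ∑ x, α x * W.dimVector x := by
  obtain ⟨V, hV⟩ := hex
  have hgen : IsGeneral α W V := by
    rw [isGeneral_iff]
    apply le_antisymm
    · refine le_csInf (Set.range_nonempty _) ?_
      rintro _ ⟨V', rfl⟩
      have h1 := homDim_add_finrank_range V W
      have h2 := homDim_add_finrank_range V' W
      have h3 := hle V'
      change homDim (ofPoint V) W ≤ homDim (ofPoint V') W
      omega
    · exact Nat.sInf_le ⟨V, rfl⟩
  rw [genHom_eq hgen, ← homDim_add_finrank_range V W, le_antisymm hV (hle V)]

theorem genHom_add_eq_genExt_add [∀ x y : Q, Fintype (x ⟶ y)]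
    (W : QuiverRep.{u, v, v', w} F Q) :
    genHom α W + ∑ x, ∑ y, ∑ _a : x ⟶ y, α x * W.dimVector y
      = genExt α W + ∑ x, α x * W.dimVector x := by
  obtain ⟨V, hV⟩ := exists_isGeneral α W
  rw [genHom_eq hV, genExt_eq hV]
  have := homDim_add_eq_extDim_add (ofPoint V) W
  rwa [dimVector_ofPoint] at this

/-- `hom(dα, W)` is an affine multiple of `d` for large `d`. -/
theorem exists_genHom_smul_add_eq [Infinite F] [∀ x y : Q, Fintype (x ⟶ y)]
    (α : Q → ℕ) (W : QuiverRep.{u, v, v', w} F Q) :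
    ∃ r : ℕ, ∀ d : ℕ, 1 ≤ d →
      min (∑ x, α x * W.dimVector x) (∑ x, ∑ y, ∑ _a : x ⟶ y, α x * W.dimVector y) ≤ d + 1 →
      genHom (d • α) W + r * d = d * ∑ x, α x * W.dimVector x := by
  classical
  obtain ⟨r, hr⟩ := exists_pencil_rank_eq_mul (diffCoeff α W)
  refine ⟨r, fun d hd hmin => ?_⟩
  have hcard : min (Fintype.card (RowIndex α W)) (Fintype.card (ColIndex α W)) ≤ d + 1 := by
    have hcol : Fintype.card (ColIndex α W) = ∑ x, α x * W.dimVector x := by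
      simp [Fintype.card_sigma]
    have hrow : Fintype.card (RowIndex α W)
        = ∑ x, ∑ y, ∑ _a : x ⟶ y, α x * W.dimVector y := by
      simp only [Fintype.card_sigma, Fintype.card_prod, Fintype.card_fin, Fintype.sum_sigma]
    rwa [hcol, hrow, min_comm]
  obtain ⟨hle, T, hT⟩ := hr d hd hcard
  -- A maximal `T` need not come from a representation; normalised to `T' none = 1`, it does.
  obtain ⟨T', hT'1, hT'⟩ := exists_pencil_rank_le_of_eq_one (diffCoeff α W) T none
  obtain ⟨V, hV⟩ := exists_blockMatrices_eq hT'1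
  have h := genHom_add_of_forall_finrank_range_le (α := d • α) (r := r * d) W
    (fun V => (finrank_range_diff V W).trans_le (hle _))
    ⟨V, by rw [finrank_range_diff, hV, ← hT]; exact hT'⟩
  rw [h, Finset.mul_sum]
  exact Finset.sum_congr rfl fun x _ => by simp [mul_assoc]

end QuiverRep

/-! ### The limits and the bound. -/

theorem mainTheorem7 {F : Type u} [Field F] [Infinite F]
    {Q : Type v} [Quiver.{v'} Q] [Fintype Q] [∀ x y : Q, Fintype (x ⟶ y)]
    (α β : Q → ℕ) (W : QuiverRep.{u, v, v', w} F Q) (hW : W.dimVector = β) :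
    Tendsto (fun d : ℕ => (QuiverRep.genHom (d • α) W : ℝ) / d) atTop
        (𝓝 (QuiverRep.nchom α W)) ∧
    Tendsto (fun d : ℕ => (QuiverRep.genExt (d • α) W : ℝ) / d) atTop
        (𝓝 (QuiverRep.ncext α W)) ∧
    ∀ d : ℕ, 1 ≤ d →
      min ((∑ x, (α x : ℤ) * (β x : ℤ)) - 1)
          ((∑ x, ∑ y, ∑ _a : x ⟶ y, (α x : ℤ) * (β y : ℤ)) - 1) ≤ (d : ℤ) →
      QuiverRep.nchom α W = (QuiverRep.genHom (d • α) W : ℝ) / d ∧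
      QuiverRep.ncext α W = (QuiverRep.genExt (d • α) W : ℝ) / d := by
  subst hW
  obtain ⟨r, hr⟩ := QuiverRep.exists_genHom_smul_add_eq α W
  set N := ∑ x, α x * W.dimVector x with hN
  set M := ∑ x, ∑ y, ∑ _a : x ⟶ y, α x * W.dimVector y with hM
  have hhom : ∀ d : ℕ, 1 ≤ d → min N M ≤ d + 1 →
      (QuiverRep.genHom (d • α) W : ℝ) / d = (N : ℝ) - r := by
    intro d hd hmin
    have hd' : (d : ℝ) ≠ 0 := by exact_mod_cast (by omega : d ≠ 0)
    have h : (QuiverRep.genHom (d • α) W : ℝ) + r * d = d * N := by exact_mod_cast hr d hd hmin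
    rw [div_eq_iff hd']
    linarith
  have hext : ∀ d : ℕ, 1 ≤ d → min N M ≤ d + 1 →
      (QuiverRep.genExt (d • α) W : ℝ) / d = (M : ℝ) - r := by
    intro d hd hmin
    have hd' : (d : ℝ) ≠ 0 := by exact_mod_cast (by omega : d ≠ 0)
    have h : (QuiverRep.genHom (d • α) W : ℝ) + r * d = d * N := by exact_mod_cast hr d hd hmin
    have h1 := QuiverRep.genHom_add_eq_genExt_add (α := d • α) W
    have hM' : ∑ x, ∑ y, ∑ _a : x ⟶ y, (d • α) x * W.dimVector y = d * M := by
      simp only [hM, Finset.mul_sum, Pi.smul_apply, smul_eq_mul, mul_assoc]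
    have hN' : ∑ x, (d • α) x * W.dimVector x = d * N := by
      simp only [hN, Finset.mul_sum, Pi.smul_apply, smul_eq_mul, mul_assoc]
    rw [hM', hN'] at h1
    have h2 : (QuiverRep.genHom (d • α) W : ℝ) + d * M = QuiverRep.genExt (d • α) W + d * N := by
      exact_mod_cast h1
    rw [div_eq_iff hd']
    linarith
  have hev : ∀ᶠ d : ℕ in atTop, 1 ≤ d ∧ min N M ≤ d + 1 := by
    filter_upwards [eventually_ge_atTop (max 1 (min N M))] with d hd
    exact ⟨(le_max_left _ _).trans hd, ((le_max_right _ _).trans hd).trans (Nat.le_succ d)⟩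
  have thom : Tendsto (fun d : ℕ => (QuiverRep.genHom (d • α) W : ℝ) / d) atTop
      (𝓝 ((N : ℝ) - r)) :=
    tendsto_const_nhds.congr' (hev.mono fun d hd => (hhom d hd.1 hd.2).symm)
  have text : Tendsto (fun d : ℕ => (QuiverRep.genExt (d • α) W : ℝ) / d) atTop
      (𝓝 ((M : ℝ) - r)) :=
    tendsto_const_nhds.congr' (hev.mono fun d hd => (hext d hd.1 hd.2).symm)
  have hnchom : QuiverRep.nchom α W = (N : ℝ) - r := thom.limUnder_eq
  have hncext : QuiverRep.ncext α W = (M : ℝ) - r := text.limUnder_eq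
  refine ⟨hnchom ▸ thom, hncext ▸ text, fun d hd hmin => ?_⟩
  -- The bound is stated in `ℤ`, so `- 1` is not truncated when a sum is zero; in `ℕ` it becomes a
  -- comparison with `d + 1`.
  have hmin' : min N M ≤ d + 1 := by
    have h : min ((N : ℤ) - 1) ((M : ℤ) - 1) ≤ d := by
      rw [hN, hM]
      push_cast
      exact hmin
    omega
  exact ⟨hnchom.trans (hhom d hd hmin').symm, hncext.trans (hext d hd hmin').symm⟩
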